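/- Let $\Delta>0$, let $\Theta\subset\mathbb{R}^p$, and for each $\gamma\in\Theta$ let $X(t;\gamma)$ be a real-valued process in continuous time whose sampled sequence $X_t^{(\gamma)}=X(t\Delta;\gamma)$, $t\in\mathbb{Z}$, has mean zero, is second-order stationary and has spectral density $f(\cdot;\gamma)$ on $[-\pi/\Delta,\pi/\Delta]$, i.e. $E\{X^{(\gamma)}_tX^{(\gamma)}_{t-\tau}\}=\frac1{2\pi}\int_{-\pi/\Delta}^{\pi/\Delta}f(\omega;\gamma)e^{i\omega\tau\Delta}\,d\omega$ for all integers $t,\tau$. Let $\theta$ be the true parameter and suppose that the observed sequence $X_t=X_t^{(\theta)}$ is Gaussian. For $n\ge1$ let $$\Omega_n=\Big\{\tfrac{2\pi k}{n\Delta}:\ k=-\lceil n/2\rceil+1,\dots,\lfloor n/2\rfloor\Big\},\qquad I_n(\omega)=\frac{\Delta}{n}\Big|\sum_{t=1}^nX_te^{-i\omega t\Delta}\Big|^2,$$ $$\overline f_n(\omega;\gamma)=\int_{-\pi/\Delta}^{\pi/\Delta}f(\nu;\gamma)\,\frac{\Delta}{2\pi n}\,\frac{\sin^2\{n(\omega-\nu)\Delta/2\}}{\sin^2\{(\omega-\nu)\Delta/2\}}\,d\nu$$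 (the expected periodogram), and let $$\ell_D(\gamma)=-\sum_{\omega\in\Omega_n}\Big\{\log\overline f_n(\omega;\gamma)+\frac{I_n(\omega)}{\overline f_n(\omega;\gamma)}\Big\}$$ be the de-biased Whittle likelihood. Assume: 1. $\Theta$ is compact and $\theta$ lies in the interior of $\Theta$. 2. There are constants $0<f_{\min}\le f_{\max}<\infty$ with $f_{\min}\le f(\omega;\gamma)\le f_{\max}$ for all $\gamma\in\Theta$ and $\omega\in[-\pi/\Delta,\pi/\Delta]$. 3. If $\gamma\ne\gamma'$ in $\Theta$, then $f(\omega;\gamma)\ne f(\omega;\gamma')$ on a set of $\omega\in[-\pi/\Delta,\pi/\Delta]$ of non-zero Lebesgue measure. 4. $f(\omega;\gamma)$ is continuous in $\gamma\in\Theta$ for each $\omega$, and Riemann integrable in $\omega\in[-\pi/\Delta,\pi/\Delta]$ for each $\gamma$. 5. For all $n\ge1$ and $\omega\in[-\pi/\Delta,\pi/\Delta]$, $\overline f_n(\omega;\cdot)$ is twice continuously differentiable on the interior of $\Theta$, with first and second derivatives bounded in norm uniformly in $n$, $\omega$ and $\gamma$; and for every direction $u\in\mathbb{R}^p\setminus\{0\}$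 the number of frequencies $\omega\in\Omega_n$ at which the derivative at the true parameter is non-zero in that direction, $u^{T}\nabla_\theta\overline f_n(\omega;\theta)\ne0$, is of exact order $n$ as $n\to\infty$. Then any maximiser $\hat\theta=\hat\theta_n\in\arg\max_{\gamma\in\Theta}\ell_D(\gamma)$ satisfies $$\hat\theta=\theta+\mathcal{O}_P(n^{-1/2}),$$ that is, for every $\varepsilon>0$ there is $M$ such that $\Pr\{\|\hat\theta_n-\theta\|>Mn^{-1/2}\}\le\varepsilon$ for all sufficiently large $n$. No continuity of $f$ in $\omega$ is required. -/

import Mathlib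

open MeasureTheory ProbabilityTheory Filter Asymptotics
open scoped Real

noncomputable section

namespace DebiasedWhittle

/-- The sequence `X_t = X(tΔ)`, `t ∈ ℤ`, sampled from a continuous-time process `X` at interval `Δ`. -/
def sampled {Ω : Type*} (X : ℝ → Ω → ℝ) (Δ : ℝ) : ℤ → Ω → ℝ :=
  fun t w => X ((t : ℝ) * Δ) w

/-- `Y` is a zero-mean second-order stationary sequence of real random variables, sampled at
interval `Δ`, whose autocovariance sequence is
`s(τ) = (1 / 2π) ∫_{-π/Δ}^{π/Δ} g(ω) exp(i ω τ Δ) dω`, that is, with spectral density `g`. -/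
structure HasSpectralDensity {Ω : Type*} [MeasurableSpace Ω] (P : Measure Ω)
    (Y : ℤ → Ω → ℝ) (Δ : ℝ) (g : ℝ → ℝ) : Prop where
  memLp : ∀ t, MemLp (Y t) 2 P
  mean_zero : ∀ t, ∫ w, Y t w ∂P = 0
  integrable : IntervalIntegrable g volume (-(π / Δ)) (π / Δ)
  autocov : ∀ t τ : ℤ,
    ((∫ w, Y t w * Y (t - τ) w ∂P : ℝ) : ℂ) =
      (1 / (2 * π)) * ∫ ω in (-(π / Δ))..(π / Δ),
        (g ω : ℂ) * Complex.exp (Complex.I * ω * τ * Δ)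

/-- Riemann integrability of `g` on the interval `[a, b]`, `a < b`, viewed as a one-dimensional
box. -/
def RiemannIntegrableOn (g : ℝ → ℝ) (a b : ℝ) : Prop :=
  ∃ h : a < b,
    BoxIntegral.Integrable (⟨fun _ => a, fun _ => b, fun _ => h⟩ : BoxIntegral.Box (Fin 1))
      BoxIntegral.IntegrationParams.Riemann (fun x => g (x 0))
      (volume : Measure (Fin 1 → ℝ)).toBoxAdditive.toSMul

/-- Indices `-⌈n/2⌉ + 1, …, ⌊n/2⌋` of the Fourier frequencies. -/
def fourierIndices (n : ℕ) : Finset ℤ :=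
  Finset.Icc (-⌈(n : ℚ) / 2⌉ + 1) ⌊(n : ℚ) / 2⌋

/-- The Fourier frequency `2πk / (nΔ)`. -/
def fourierFreq (Δ : ℝ) (n : ℕ) (k : ℤ) : ℝ :=
  2 * π * k / (n * Δ)

/-- The discrete Fourier transform
`J(ω) = (Δ/n)^{1/2} ∑_{t=1}^n x_t exp(-i ω t Δ)`. -/
def dft (Δ : ℝ) (n : ℕ) (x : ℤ → ℝ) (ω : ℝ) : ℂ :=
  (√(Δ / n) : ℂ) * ∑ t ∈ Finset.Icc 1 n,
    (x (t : ℤ) : ℂ) * Complex.exp (-(Complex.I * ω * t * Δ))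

/-- The periodogram `I(ω) = |J(ω)|²`. -/
def periodogram (Δ : ℝ) (n : ℕ) (x : ℤ → ℝ) (ω : ℝ) : ℝ :=
  ‖dft Δ n x ω‖ ^ 2

/-- The Fejér kernel `(Δ / 2πn) sin²(nωΔ/2) / sin²(ωΔ/2)`, extended by continuity to the zeros
of the denominator. -/
def fejer (Δ : ℝ) (n : ℕ) (ω : ℝ) : ℝ :=
  if Real.sin (ω * Δ / 2) = 0 then Δ * n / (2 * π)
  else Δ / (2 * π * n) * (Real.sin (n * ω * Δ / 2) ^ 2 / Real.sin (ω * Δ / 2) ^ 2)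

/-- The expected periodogram for the spectral density `g`. -/
def expectedPeriodogram (Δ : ℝ) (n : ℕ) (g : ℝ → ℝ) (ω : ℝ) : ℝ :=
  ∫ ν in (-(π / Δ))..(π / Δ), g ν * fejer Δ n (ω - ν)

/-- The de-biased Whittle likelihood `ℓ_D(γ)` of the data `x_1, …, x_n`, for the parametric
family of spectral densities `f(·; γ)`. -/
def debiasedWhittle {E : Type*} (Δ : ℝ) (f : ℝ → E → ℝ) (n : ℕ) (x : ℤ → ℝ) (γ : E) : ℝ :=
  -∑ k ∈ fourierIndices n,
    (Real.log (expectedPeriodogram Δ n (fun ν => f ν γ) (fourierFreq Δ n k)) +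
      periodogram Δ n x (fourierFreq Δ n k) /
        expectedPeriodogram Δ n (fun ν => f ν γ) (fourierFreq Δ n k))

/-- `Z_n = O_P(r_n)`. -/
def IsBigOInProb {Ω E : Type*} [MeasurableSpace Ω] [Norm E] (P : Measure Ω)
    (Z : ℕ → Ω → E) (r : ℕ → ℝ) : Prop :=
  ∀ ε : ℝ, 0 < ε → ∃ M : ℝ, ∀ᶠ n in atTop, P {w | M * r n < ‖Z n w‖} ≤ ENNReal.ofReal ε

end DebiasedWhittle

end

/-!
The likelihood is studied through the basic inequality at a maximiser `γ`. With
`a k γ` the expected periodogram at the `k`-th Fourier frequency and `N k = I k - a k θ` the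
centred periodogram, `log y ≤ y - 1` turns `ℓ_D(γ) ≥ ℓ_D(θ)` into
`(4 fmax²)⁻¹ ∑ (a k γ - a k θ)² ≤ |∑ ((a k γ)⁻¹ - (a k θ)⁻¹) N k|`
(`sum_sq_sub_le_of_sum_log_le`). The rate follows from a lower bound for the left-hand side, an upper
bound for the second moments of the noise, and a uniform control of the right-hand side.

*Separation* (`exists_sum_sq_sub_ge`): `∑ (a k γ - a k θ)² ≥ c n ‖γ - θ‖²` on `Θ`. The expected
periodogram is the Fourier series of the tapered covariances `(1 - |τ| / n) r(τ)`, so correlating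
`a k γ - a k θ` with `cos (m ω_k Δ)` gives back the difference of the covariances at lag `m`, up to an
aliasing error of relative size `m / n`. It remains to find finitely many lags that separate the
parameters linearly. Away from `θ` this is identifiability and compactness. Near `θ`, the derivative of
some expected periodogram, at some `n` and frequency, is non-zero in each given direction; by
compactness of the sphere finitely many of them serve all directions, and each involves finitely many
covariances. Thus a derivative that is non-zero, however small, at one sample size already forces
information of order `n` for all large sample sizes.

*Noise* (`periodogram_fluctuation`): Isserlis' formula and the orthogonality of the discrete Fourier
transform reduce the variance of `∑ b k N k` to `∑ₛ ∑ₜ r(s - t)²`, which is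
`(n / 2πΔ) ∫ f f̄ₙ = O(n)`.

*Uniformity* (`norm_sub_le_of_noise_le`, `isBigOInProb_of_noise`): the family of spectral densities is
compact in `L¹`, and the Fejér kernel sampled at the Fourier frequencies is a partition of unity, so
finitely many parameters approximate all others in mean square, uniformly in `n`; with Cauchy-Schwarz
this gives consistency. Near `θ` the reciprocals are expanded to first order. The linear term is a
finite-dimensional sum of order `√n`. The remainder on the ball of radius `ρ` is Lipschitz with constant
of order `ρ`, so after rescaling a net of fixed size suffices on each dyadic scale, and Chebyshev's
inequality, with failure probability `O(1 / n)` on each scale, covers the `O(√n)` relevant scales.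
-/

namespace DebiasedWhittle

/-! ### Elementary inequality and Gaussian fourth moments -/

/-- With `y = b / a`, the bound `log √y ≤ √y - 1` gives `y - 1 - log y ≥ (√y - 1)²`, and
`(a - b)² = (√y - 1)² a² (√y + 1)²`. -/
theorem sq_sub_div_le_log_div_add {a b F : ℝ} (ha : 0 < a) (hb : 0 < b) (haF : a ≤ F)
    (hbF : b ≤ F) : (a - b) ^ 2 / (4 * F ^ 2) ≤ Real.log a - Real.log b + b / a - 1 := by
  have hF : 0 < F := ha.trans_le haF
  set y := b / a with hy
  have hy0 : 0 < y := div_pos hb ha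
  have h1 : Real.log b - Real.log a ≤ 2 * (√y - 1) := by
    rw [← Real.log_div hb.ne' ha.ne', ← hy]
    have := Real.log_le_sub_one_of_pos (Real.sqrt_pos.2 hy0)
    rw [Real.log_sqrt hy0.le] at this
    linarith
  have hsq : √y ^ 2 = y := Real.sq_sqrt hy0.le
  have hs0 : 0 ≤ √y := Real.sqrt_nonneg y
  have hs1 : a * (√y + 1) ^ 2 ≤ 4 * F := by
    have : a * y = b := by rw [hy]; field_simp
    nlinarith [sq_nonneg (√y - 1)]
  have hb' : b = a * √y ^ 2 := by rw [hsq, hy]; field_simp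
  have h2 : (a - b) ^ 2 / (4 * F ^ 2) ≤ (√y - 1) ^ 2 := by
    rw [div_le_iff₀ (by positivity)]
    have : (a - b) ^ 2 = (√y - 1) ^ 2 * (a * (a * (√y + 1) ^ 2)) := by
      rw [hb']; ring
    rw [this]
    refine mul_le_mul_of_nonneg_left ?_ (sq_nonneg _)
    calc a * (a * (√y + 1) ^ 2) ≤ F * (4 * F) := by gcongr
      _ = 4 * F ^ 2 := by ring
  nlinarith

/-- The fourth moment is the fourth derivative at `0` of the moment generating function
`exp (v t² / 2)`. -/
theorem integral_pow_four_gaussianReal (v : NNReal) :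
    ∫ x, x ^ 4 ∂gaussianReal 0 v = 3 * (v : ℝ) ^ 2 := by
  have key := iteratedDeriv_mgf_zero (X := fun x : ℝ => x) (μ := gaussianReal 0 v) (by simp) 4
  -- Derivatives of a polynomial times `exp (v t² / 2)` keep that form.
  have hd : ∀ p p' : ℝ → ℝ, (∀ t, HasDerivAt p (p' t) t) →
      deriv (fun t => p t * Real.exp (v * t ^ 2 / 2)) =
        fun t => (p' t + v * t * p t) * Real.exp (v * t ^ 2 / 2) := by
    intro p p' h
    ext t
    have h1 : HasDerivAt (fun t : ℝ => (v : ℝ) * t ^ 2 / 2) (v * t) t :=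
      (((hasDerivAt_pow 2 t).const_mul (v : ℝ)).div_const 2).congr_deriv (by simp; ring)
    rw [((h t).fun_mul h1.exp).deriv]
    ring
  have e : (fun t : ℝ => Real.exp (0 * t + v * t ^ 2 / 2)) =
      fun t => (1 : ℝ) * Real.exp (v * t ^ 2 / 2) := by ext t; simp
  rw [mgf_fun_id_gaussianReal, e, iteratedDeriv_eq_iterate] at key
  simp only [Function.iterate_succ, Function.iterate_zero, Function.comp, id] at key
  rw [hd (fun _ => 1) (fun _ => 0) (fun t => hasDerivAt_const t 1),
    hd (fun t => 0 + v * t * 1) (fun _ => v)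
      (fun t => (((hasDerivAt_id t).const_mul (v : ℝ)).mul_const 1 |>.const_add 0).congr_deriv
        (by simp)),
    hd (fun t => v + v * t * (0 + v * t * 1)) (fun t => 2 * v ^ 2 * t)
      (fun t => ((((hasDerivAt_pow 2 t).const_mul ((v : ℝ) ^ 2)).const_add (v : ℝ)).congr_deriv
        (by simp; ring)).congr_of_eventuallyEq (.of_forall fun t => by ring)),
    hd (fun t => 2 * v ^ 2 * t + v * t * (v + v * t * (0 + v * t * 1)))
      (fun t => 3 * v ^ 2 + 3 * v ^ 3 * t ^ 2)
      (fun t => ((((hasDerivAt_id t).const_mul (3 * (v : ℝ) ^ 2)).add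
        ((hasDerivAt_pow 3 t).const_mul ((v : ℝ) ^ 3))).congr_deriv
        (by simp; ring)).congr_of_eventuallyEq
          (.of_forall fun t => by simp only [Pi.add_apply, id]; ring))] at key
  simpa using key.symm

section IsserlisFormula

variable {Ω : Type*} [MeasurableSpace Ω] {P : Measure Ω}

theorem integral_pow_four_of_hasGaussianLaw {U : Ω → ℝ} (h : HasGaussianLaw U P)
    (h0 : ∫ w, U w ∂P = 0) : ∫ w, U w ^ 4 ∂P = 3 * (∫ w, U w ^ 2 ∂P) ^ 2 := by
  have hm := h.map_eq_gaussianReal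
  have hv : Var[U; P] = ∫ w, U w ^ 2 ∂P := by
    rw [variance_of_integral_eq_zero h.aemeasurable h0]
  have h4 : ∫ w, U w ^ 4 ∂P = ∫ x, x ^ 4 ∂(P.map U) := by
    rw [integral_map h.aemeasurable (by fun_prop)]
  rw [h4, hm, h0, integral_pow_four_gaussianReal, Real.coe_toNNReal _ (variance_nonneg U P), hv]

/-- Isserlis' formula for the fourth mixed moment `E U²V²`, obtained by polarisation from the
fourth moments of `U ± V`. -/
theorem integral_sq_mul_sq_of_gaussian {U V : Ω → ℝ}
    (h : HasGaussianLaw (fun w => (U w, V w)) P)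
    (hU0 : ∫ w, U w ∂P = 0) (hV0 : ∫ w, V w ∂P = 0) :
    ∫ w, U w ^ 2 * V w ^ 2 ∂P =
      (∫ w, U w ^ 2 ∂P) * (∫ w, V w ^ 2 ∂P) + 2 * (∫ w, U w * V w ∂P) ^ 2 := by
  have := h.isProbabilityMeasure
  have iU := h.fst.integrable
  have iV := h.snd.integrable
  have mU := h.fst.memLp (p := 4) (by simp)
  have mV := h.snd.memLp (p := 4) (by simp)
  have mA := h.fun_add.memLp (p := 4) (by simp)
  have mS := h.fun_sub.memLp (p := 4) (by simp)
  have i4 : ∀ W : Ω → ℝ, MemLp W 4 P → Integrable (fun w => W w ^ 4) P := fun W hW => by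
    have := hW.integrable_norm_pow (p := 4) (by norm_num)
    refine this.congr (.of_forall fun w => ?_)
    simp [Real.norm_eq_abs, Even.pow_abs (show Even 4 by decide)]
  have i2 : ∀ W : Ω → ℝ, MemLp W 4 P → Integrable (fun w => W w ^ 2) P := fun W hW =>
    (hW.mono_exponent (p := 2) (by norm_num)).integrable_sq
  have iUV : Integrable (fun w => U w * V w) P :=
    (mU.mono_exponent (p := 2) (by norm_num)).integrable_mul
      (mV.mono_exponent (p := 2) (by norm_num))
  have eA := integral_pow_four_of_hasGaussianLaw h.fun_add
    (by rw [integral_add iU iV, hU0, hV0, add_zero])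
  have eS := integral_pow_four_of_hasGaussianLaw h.fun_sub
    (by rw [integral_sub iU iV, hU0, hV0, sub_zero])
  have eU := integral_pow_four_of_hasGaussianLaw h.fst hU0
  have eV := integral_pow_four_of_hasGaussianLaw h.snd hV0
  have sA : ∫ w, (U w + V w) ^ 2 ∂P =
      ∫ w, U w ^ 2 ∂P + 2 * ∫ w, U w * V w ∂P + ∫ w, V w ^ 2 ∂P := by
    rw [← integral_const_mul, ← integral_add (i2 U mU) (iUV.const_mul 2),
      ← integral_add ((i2 U mU).fun_add (iUV.const_mul 2)) (i2 V mV)]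
    exact integral_congr_ae (.of_forall fun w => by ring)
  have sS : ∫ w, (U w - V w) ^ 2 ∂P =
      ∫ w, U w ^ 2 ∂P - 2 * ∫ w, U w * V w ∂P + ∫ w, V w ^ 2 ∂P := by
    have i : Integrable (fun w => U w ^ 2 - 2 * (U w * V w)) P :=
      (i2 U mU).sub (iUV.const_mul 2)
    rw [← integral_const_mul, ← integral_sub (i2 U mU) (iUV.const_mul 2),
      ← integral_add i (i2 V mV)]
    exact integral_congr_ae (.of_forall fun w => by ring)
  have s4 : ∫ w, U w ^ 2 * V w ^ 2 ∂P =
      (1 / 12) * ((∫ w, (U w + V w) ^ 4 ∂P + ∫ w, (U w - V w) ^ 4 ∂P) -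
        2 * (∫ w, U w ^ 4 ∂P + ∫ w, V w ^ 4 ∂P)) := by
    rw [← integral_add (i4 _ mA) (i4 _ mS), ← integral_add (i4 _ mU) (i4 _ mV),
      ← integral_const_mul, ← integral_sub ((i4 _ mA).fun_add (i4 _ mS))
        (((i4 _ mU).fun_add (i4 _ mV)).const_mul 2), ← integral_const_mul]
    exact integral_congr_ae (.of_forall fun w => by ring)
  rw [s4, eA, eS, eU, eV, sA, sS]
  ring

end IsserlisFormula

/-! ### The Fejér kernel and the Fourier frequencies -/

theorem two_mul_sin_mul_sum_cos (n : ℕ) (x : ℝ) :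
    2 * Real.sin (x / 2) * ∑ t ∈ Finset.Icc 1 n, Real.cos (t * x) =
      Real.sin (n * x + x / 2) - Real.sin (x / 2) := by
  induction n with
  | zero => simp
  | succ n ih =>
    rw [Finset.sum_Icc_succ_top (by omega), mul_add, ih]
    have h1 : (n : ℝ) * x + x / 2 = ((n + 1 : ℕ) : ℝ) * x - x / 2 := by push_cast; ring
    rw [h1, Real.sin_sub, Real.sin_add]
    ring

theorem two_mul_sin_mul_sum_sin (n : ℕ) (x : ℝ) :
    2 * Real.sin (x / 2) * ∑ t ∈ Finset.Icc 1 n, Real.sin (t * x) =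
      Real.cos (x / 2) - Real.cos (n * x + x / 2) := by
  induction n with
  | zero => simp
  | succ n ih =>
    rw [Finset.sum_Icc_succ_top (by omega), mul_add, ih]
    have h1 : (n : ℝ) * x + x / 2 = ((n + 1 : ℕ) : ℝ) * x - x / 2 := by push_cast; ring
    rw [h1, Real.cos_sub, Real.cos_add]
    ring

theorem sin_sq_mul_sum_sq (n : ℕ) (x : ℝ) :
    Real.sin (x / 2) ^ 2 * ((∑ t ∈ Finset.Icc 1 n, Real.cos (t * x)) ^ 2 +
      (∑ t ∈ Finset.Icc 1 n, Real.sin (t * x)) ^ 2) = Real.sin (n * x / 2) ^ 2 := by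
  have h1 := two_mul_sin_mul_sum_cos n x
  have h2 := two_mul_sin_mul_sum_sin n x
  have h3 : Real.cos (n * x) = 1 - 2 * Real.sin (n * x / 2) ^ 2 := by
    have := Real.cos_two_mul (n * x / 2)
    rw [Real.cos_sq'] at this
    rw [show (n : ℝ) * x = 2 * (n * x / 2) by ring, this]
    ring_nf
  have h4 : Real.cos (n * x) = Real.cos (n * x + x / 2) * Real.cos (x / 2) +
      Real.sin (n * x + x / 2) * Real.sin (x / 2) := by
    rw [← Real.cos_sub]; ring_nf
  have h5 := Real.sin_sq_add_cos_sq (x / 2)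
  have h6 := Real.sin_sq_add_cos_sq (n * x + x / 2)
  have h7 : 4 * (Real.sin (x / 2) ^ 2 * ((∑ t ∈ Finset.Icc 1 n, Real.cos (t * x)) ^ 2 +
      (∑ t ∈ Finset.Icc 1 n, Real.sin (t * x)) ^ 2)) =
      (2 * Real.sin (x / 2) * ∑ t ∈ Finset.Icc 1 n, Real.cos (t * x)) ^ 2 +
      (2 * Real.sin (x / 2) * ∑ t ∈ Finset.Icc 1 n, Real.sin (t * x)) ^ 2 := by ring
  rw [h1, h2] at h7
  linear_combination h7 / 4 + h5 / 4 + h6 / 4 - h3 / 2 + h4 / 2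

theorem sum_sum_cos_sub (n : ℕ) (x : ℝ) :
    ∑ s ∈ Finset.Icc 1 n, ∑ t ∈ Finset.Icc 1 n, Real.cos (((s : ℝ) - t) * x) =
      (∑ t ∈ Finset.Icc 1 n, Real.cos (t * x)) ^ 2 +
      (∑ t ∈ Finset.Icc 1 n, Real.sin (t * x)) ^ 2 := by
  rw [pow_two, pow_two, Finset.sum_mul_sum, Finset.sum_mul_sum, ← Finset.sum_add_distrib]
  refine Finset.sum_congr rfl fun s _ => ?_
  rw [← Finset.sum_add_distrib]
  refine Finset.sum_congr rfl fun t _ => ?_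
  rw [sub_mul, Real.cos_sub]

/-- The Fejér kernel as a trigonometric polynomial of degree `n - 1`. The value assigned to it at the
zeros of the denominator agrees with this polynomial. -/
theorem fejer_eq (Δ : ℝ) {n : ℕ} (hn : 0 < n) (ω : ℝ) :
    fejer Δ n ω = Δ / (2 * π * n) *
      ∑ s ∈ Finset.Icc 1 n, ∑ t ∈ Finset.Icc 1 n, Real.cos (((s : ℝ) - t) * (ω * Δ)) := by
  have hn' : (n : ℝ) ≠ 0 := by positivity
  unfold fejer
  split_ifs with h
  · have h1 : ∀ s t : ℕ, Real.cos (((s : ℝ) - t) * (ω * Δ)) = 1 := by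
      intro s t
      obtain ⟨k, hk⟩ := Real.sin_eq_zero_iff.1 h
      have : ((s : ℝ) - t) * (ω * Δ) = ((((s : ℤ) - t) * k : ℤ) : ℝ) * (2 * π) := by
        push_cast
        linear_combination (-2) * ((s : ℝ) - t) * hk
      rw [this, Real.cos_int_mul_two_pi]
    simp only [h1, Finset.sum_const, Nat.card_Icc, nsmul_eq_mul]
    field_simp
    simp
  · rw [sum_sum_cos_sub, ← mul_div_assoc, mul_div_assoc]
    congr 1
    rw [div_eq_iff (pow_ne_zero 2 h), mul_comm _ (Real.sin _ ^ 2), sin_sq_mul_sum_sq, mul_assoc]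

theorem fejer_nonneg {Δ : ℝ} (hΔ : 0 < Δ) (n : ℕ) (ω : ℝ) : 0 ≤ fejer Δ n ω := by
  unfold fejer
  split_ifs <;> positivity

theorem exists_fourierIndices_eq_Ico (n : ℕ) :
    ∃ a : ℤ, fourierIndices n = Finset.Ico a (a + n) := by
  refine ⟨-⌈(n : ℚ) / 2⌉ + 1, ?_⟩
  have h : ⌊(n : ℚ) / 2⌋ + ⌈(n : ℚ) / 2⌉ = n := by
    obtain ⟨m, rfl | rfl⟩ := n.even_or_odd'
    · have : ((2 * m : ℕ) : ℚ) / 2 = (m : ℤ) := by push_cast; ring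
      rw [this, Int.floor_intCast, Int.ceil_intCast]; push_cast; ring
    · have h1 : ⌊((2 * m + 1 : ℕ) : ℚ) / 2⌋ = m := by
        rw [Int.floor_eq_iff]; push_cast; constructor <;> linarith
      have h2 : ⌈((2 * m + 1 : ℕ) : ℚ) / 2⌉ = m + 1 := by
        rw [Int.ceil_eq_iff]; push_cast; constructor <;> linarith
      rw [h1, h2]; push_cast; ring
  ext k
  simp only [fourierIndices, Finset.mem_Icc, Finset.mem_Ico]
  constructor <;> rintro ⟨h1, h2⟩ <;> constructor <;> omega

theorem card_fourierIndices (n : ℕ) : (fourierIndices n).card = n := by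
  obtain ⟨a, h⟩ := exists_fourierIndices_eq_Ico n
  simp [h]

theorem fourierFreq_mem_Icc {Δ : ℝ} (hΔ : 0 < Δ) {n : ℕ} (hn : 0 < n) {k : ℤ}
    (hk : k ∈ fourierIndices n) : fourierFreq Δ n k ∈ Set.Icc (-(π / Δ)) (π / Δ) := by
  have hn' : (0 : ℝ) < n := by positivity
  simp only [fourierIndices, Finset.mem_Icc] at hk
  have h2 : (k : ℚ) ≤ n / 2 := Int.le_floor.1 hk.2
  have h1 : -(n / 2 : ℚ) ≤ k := by
    have := Int.ceil_lt_add_one ((n : ℚ) / 2)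
    have h3 : ((-⌈(n : ℚ) / 2⌉ + 1 : ℤ) : ℚ) ≤ k := by exact_mod_cast hk.1
    push_cast at h3
    linarith
  have h2' : (k : ℝ) ≤ n / 2 := by
    have := (Rat.cast_le (K := ℝ)).2 h2
    simpa using this
  have h1' : -(n / 2 : ℝ) ≤ k := by
    have := (Rat.cast_le (K := ℝ)).2 h1
    simpa using this
  have e : fourierFreq Δ n k = (π / Δ) * (2 * k / n) := by
    unfold fourierFreq; field_simp
  have hp : 0 < π / Δ := by positivity
  have h3 : 2 * (k : ℝ) / n ≤ 1 := by rw [div_le_one hn']; linarith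
  have h4 : -1 ≤ 2 * (k : ℝ) / n := by rw [le_div_iff₀ hn']; linarith
  rw [e]
  constructor <;> nlinarith

/-- Orthogonality: the numbers `exp (i ω Δ)`, for `ω` a Fourier frequency, are all `n`-th roots of
unity. -/
theorem sum_cos_fourierFreq {Δ : ℝ} (hΔ : 0 < Δ) {n : ℕ} (hn : 0 < n) (m : ℤ) (φ : ℝ) :
    ∑ k ∈ fourierIndices n, Real.cos (m * (fourierFreq Δ n k * Δ) + φ) =
      if (n : ℤ) ∣ m then n * Real.cos φ else 0 := by
  have hn' : (n : ℝ) ≠ 0 := by positivity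
  have hnC : (n : ℂ) ≠ 0 := by exact_mod_cast hn'
  have hfr : ∀ k : ℤ, fourierFreq Δ n k * Δ = 2 * π * k / n := fun k => by
    unfold fourierFreq; field_simp
  simp only [hfr]
  split_ifs with h
  · obtain ⟨q, rfl⟩ := h
    have : ∀ k : ℤ, Real.cos ((((n : ℤ) * q : ℤ) : ℝ) * (2 * π * k / n) + φ) = Real.cos φ := by
      intro k
      have : (((n : ℤ) * q : ℤ) : ℝ) * (2 * π * k / n) + φ = φ + ((q * k : ℤ) : ℝ) * (2 * π) := by
        push_cast; field_simp; ring
      rw [this, Real.cos_add_int_mul_two_pi]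
    simp only [this, Finset.sum_const, card_fourierIndices, nsmul_eq_mul]
  · set z : ℂ := Complex.exp (2 * π * Complex.I * m / n) with hz
    have hz0 : z ≠ 0 := Complex.exp_ne_zero _
    have hzn : z ^ n = 1 := by
      rw [hz, ← Complex.exp_nat_mul, mul_div_cancel₀ _ hnC, mul_comm]
      exact Complex.exp_int_mul_two_pi_mul_I m
    have hz1 : z ≠ 1 := by
      intro h1
      rw [hz, Complex.exp_eq_one_iff] at h1
      obtain ⟨q, hq⟩ := h1
      apply h
      refine ⟨q, ?_⟩
      have hI : (2 * π * Complex.I : ℂ) ≠ 0 := Complex.two_pi_I_ne_zero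
      have : (m : ℂ) = n * q := by
        have h2 : (2 * π * Complex.I : ℂ) * m = (2 * π * Complex.I : ℂ) * (n * q) := by
          rw [div_eq_iff hnC] at hq
          rw [hq]; ring
        exact mul_left_cancel₀ hI h2
      exact_mod_cast this
    have hcos : ∀ k : ℤ, Real.cos (m * (2 * π * k / n) + φ) =
        (Complex.exp (φ * Complex.I) * z ^ k).re := by
      intro k
      rw [hz, ← Complex.exp_int_mul, ← Complex.exp_add]
      have : (φ : ℂ) * Complex.I + k * (2 * π * Complex.I * m / n) =
          ((m * (2 * π * k / n) + φ : ℝ) : ℂ) * Complex.I := by push_cast; ring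
      rw [this, Complex.exp_ofReal_mul_I_re]
    simp only [hcos]
    rw [← Complex.re_sum, ← Finset.mul_sum]
    obtain ⟨a, ha⟩ := exists_fourierIndices_eq_Ico n
    have hs : ∑ k ∈ fourierIndices n, z ^ k = ∑ j ∈ Finset.range n, z ^ a * z ^ j := by
      rw [ha]
      refine Finset.sum_nbij' (fun k => (k - a).toNat) (fun j => a + j) ?_ ?_ ?_ ?_ ?_
      · intro k hk; simp only [Finset.mem_Ico] at hk; simp only [Finset.mem_range]; omega
      · intro j hj; simp only [Finset.mem_range] at hj; simp only [Finset.mem_Ico]; omega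
      · intro k hk; simp only [Finset.mem_Ico] at hk; omega
      · intro j hj; simp
      · intro k hk
        simp only [Finset.mem_Ico] at hk
        rw [← zpow_natCast, ← zpow_add₀ hz0]
        congr 1; omega
    rw [hs, ← Finset.mul_sum, geom_sum_eq hz1, hzn]
    simp

theorem integral_cos_period {Δ : ℝ} (hΔ : 0 < Δ) (m : ℤ) (φ : ℝ) :
    ∫ ν in (-(π / Δ))..(π / Δ), Real.cos (m * (ν * Δ) + φ) =
      if m = 0 then 2 * π / Δ * Real.cos φ else 0 := by
  split_ifs with h
  · subst h
    simp only [Int.cast_zero, zero_mul, zero_add, intervalIntegral.integral_const, smul_eq_mul]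
    ring
  · have hm : (m : ℝ) * Δ ≠ 0 := mul_ne_zero (by exact_mod_cast h) hΔ.ne'
    have : ∀ ν : ℝ, (m : ℝ) * (ν * Δ) + φ = m * Δ * ν + φ := fun ν => by ring
    simp only [this]
    rw [intervalIntegral.integral_comp_mul_add (f := Real.cos) hm, integral_cos]
    have e1 : (m : ℝ) * Δ * (π / Δ) + φ = (m * Δ * -(π / Δ) + φ) + m * (2 * π) := by
      field_simp; ring
    rw [e1, Real.sin_add_int_mul_two_pi]
    simp

/-! ### Covariances and expected periodograms -/

/-- The real even sequence `r` of covariances whose spectral density is `g`; the real and imaginary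
parts of the Fourier coefficients are recorded separately. -/
structure IsAutocovariance (Δ : ℝ) (g : ℝ → ℝ) (r : ℤ → ℝ) : Prop where
  integrable : IntervalIntegrable g volume (-(π / Δ)) (π / Δ)
  integral_cos : ∀ τ : ℤ,
    ∫ ν in (-(π / Δ))..(π / Δ), g ν * Real.cos (τ * (ν * Δ)) = 2 * π * r τ
  integral_sin : ∀ τ : ℤ,
    ∫ ν in (-(π / Δ))..(π / Δ), g ν * Real.sin (τ * (ν * Δ)) = 0

theorem integral_mul_exp_of_intervalIntegrable {g : ℝ → ℝ} {a b : ℝ}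
    (hg : IntervalIntegrable g volume a b) (c : ℝ) :
    ∫ ν in a..b, (g ν : ℂ) * Complex.exp (((c * ν : ℝ) : ℂ) * Complex.I) =
      ((∫ ν in a..b, g ν * Real.cos (c * ν) : ℝ) : ℂ) +
        ((∫ ν in a..b, g ν * Real.sin (c * ν) : ℝ) : ℂ) * Complex.I := by
  have ic : IntervalIntegrable (fun ν => g ν * Real.cos (c * ν)) volume a b :=
    hg.mul_continuousOn (by fun_prop)
  have is : IntervalIntegrable (fun ν => g ν * Real.sin (c * ν)) volume a b :=
    hg.mul_continuousOn (by fun_prop)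
  have ic' : IntervalIntegrable (fun ν => ((g ν * Real.cos (c * ν) : ℝ) : ℂ)) volume a b :=
    ⟨ic.1.ofReal, ic.2.ofReal⟩
  have is' : IntervalIntegrable (fun ν => ((g ν * Real.sin (c * ν) : ℝ) : ℂ)) volume a b :=
    ⟨is.1.ofReal, is.2.ofReal⟩
  rw [← intervalIntegral.integral_ofReal, ← intervalIntegral.integral_ofReal,
    ← intervalIntegral.integral_mul_const, ← intervalIntegral.integral_add ic' (is'.mul_const _)]
  refine intervalIntegral.integral_congr fun ν _ => ?_
  simp only [Complex.exp_mul_I, ← Complex.ofReal_cos, ← Complex.ofReal_sin]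
  push_cast
  ring

theorem HasSpectralDensity.integral_mul_exp {Ω : Type*} [MeasurableSpace Ω] {P : Measure Ω}
    {Y : ℤ → Ω → ℝ} {Δ : ℝ} {g : ℝ → ℝ} (h : HasSpectralDensity P Y Δ g) (t τ : ℤ) :
    ∫ ν in (-(π / Δ))..(π / Δ), g ν * Real.cos (τ * (ν * Δ)) =
        2 * π * ∫ w, Y t w * Y (t - τ) w ∂P ∧
      ∫ ν in (-(π / Δ))..(π / Δ), g ν * Real.sin (τ * (ν * Δ)) = 0 := by
  have h1 := h.autocov t τ
  have h2 := integral_mul_exp_of_intervalIntegrable h.integrable (τ * Δ)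
  have h3 : ∀ ν : ℝ, Complex.I * ν * τ * Δ = (((τ * Δ : ℝ) * ν : ℝ) : ℂ) * Complex.I := by
    intro ν; push_cast; ring
  simp only [h3] at h1
  rw [h2] at h1
  have h4 : ∀ ν : ℝ, (τ : ℝ) * Δ * ν = τ * (ν * Δ) := fun ν => by ring
  simp only [h4] at h1
  set A := ∫ ν in (-(π / Δ))..(π / Δ), g ν * Real.cos (τ * (ν * Δ))
  set B := ∫ ν in (-(π / Δ))..(π / Δ), g ν * Real.sin (τ * (ν * Δ))
  have hpi : (π : ℂ) ≠ 0 := by exact_mod_cast Real.pi_ne_zero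
  have h5 : ((2 * π * ∫ w, Y t w * Y (t - τ) w ∂P : ℝ) : ℂ) = (A : ℂ) + B * Complex.I := by
    rw [Complex.ofReal_mul, h1]; push_cast; field_simp
  constructor
  · simpa using (congrArg Complex.re h5).symm
  · simpa using (congrArg Complex.im h5).symm

theorem HasSpectralDensity.integral_mul_eq {Ω : Type*} [MeasurableSpace Ω] {P : Measure Ω}
    {Y : ℤ → Ω → ℝ} {Δ : ℝ} {g : ℝ → ℝ} (h : HasSpectralDensity P Y Δ g) (s t : ℤ) :
    ∫ w, Y s w * Y t w ∂P = ∫ w, Y (s - t) w * Y 0 w ∂P := by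
  have h1 := (h.integral_mul_exp s (s - t)).1
  have h2 := (h.integral_mul_exp (s - t) (s - t)).1
  rw [h1, sub_sub_cancel, sub_self] at h2
  exact mul_left_cancel₀ (by positivity) h2

theorem HasSpectralDensity.isAutocovariance {Ω : Type*} [MeasurableSpace Ω] {P : Measure Ω}
    {Y : ℤ → Ω → ℝ} {Δ : ℝ} {g : ℝ → ℝ} (h : HasSpectralDensity P Y Δ g) :
    IsAutocovariance Δ g (fun τ => ∫ w, Y τ w * Y 0 w ∂P) where
  integrable := h.integrable
  integral_cos τ := by
    have := (h.integral_mul_exp τ τ).1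
    rwa [sub_self] at this
  integral_sin τ := (h.integral_mul_exp τ τ).2

namespace IsAutocovariance

variable {Δ : ℝ} {g g' : ℝ → ℝ} {r r' : ℤ → ℝ}

theorem neg (h : IsAutocovariance Δ g r) (τ : ℤ) : r (-τ) = r τ := by
  have h1 := h.integral_cos (-τ)
  have h2 := h.integral_cos τ
  simp only [Int.cast_neg, neg_mul, Real.cos_neg] at h1
  rw [h1] at h2
  exact mul_left_cancel₀ (by positivity) h2

theorem sub (h : IsAutocovariance Δ g r) (h' : IsAutocovariance Δ g' r') :
    IsAutocovariance Δ (fun ν => g ν - g' ν) (fun τ => r τ - r' τ) where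
  integrable := h.integrable.sub h'.integrable
  integral_cos τ := by
    simp only [sub_mul]
    rw [intervalIntegral.integral_sub (h.integrable.mul_continuousOn (by fun_prop))
      (h'.integrable.mul_continuousOn (by fun_prop)), h.integral_cos, h'.integral_cos]
    ring
  integral_sin τ := by
    simp only [sub_mul]
    rw [intervalIntegral.integral_sub (h.integrable.mul_continuousOn (by fun_prop))
      (h'.integrable.mul_continuousOn (by fun_prop)), h.integral_sin, h'.integral_sin, sub_zero]

theorem integral_cos_sub (h : IsAutocovariance Δ g r) (τ : ℤ) (ω : ℝ) :
    ∫ ν in (-(π / Δ))..(π / Δ), g ν * Real.cos (τ * ((ω - ν) * Δ)) =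
      2 * π * (r τ * Real.cos (τ * (ω * Δ))) := by
  have e : ∀ ν, g ν * Real.cos (τ * ((ω - ν) * Δ)) =
      Real.cos (τ * (ω * Δ)) * (g ν * Real.cos (τ * (ν * Δ))) +
        Real.sin (τ * (ω * Δ)) * (g ν * Real.sin (τ * (ν * Δ))) := by
    intro ν
    rw [show (τ : ℝ) * ((ω - ν) * Δ) = τ * (ω * Δ) - τ * (ν * Δ) by ring, Real.cos_sub]
    ring
  simp only [e]
  rw [intervalIntegral.integral_add
    ((h.integrable.mul_continuousOn (by fun_prop)).const_mul _)
    ((h.integrable.mul_continuousOn (by fun_prop)).const_mul _),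
    intervalIntegral.integral_const_mul, intervalIntegral.integral_const_mul,
    h.integral_cos, h.integral_sin]
  ring

/-- The expected periodogram is the Fourier series of the triangularly tapered covariances. -/
theorem expectedPeriodogram_eq (h : IsAutocovariance Δ g r) {n : ℕ} (hn : 0 < n) (ω : ℝ) :
    expectedPeriodogram Δ n g ω = Δ / n *
      ∑ s ∈ Finset.Icc 1 n, ∑ t ∈ Finset.Icc 1 n,
        r ((s : ℤ) - t) * Real.cos (((s : ℝ) - t) * (ω * Δ)) := by
  have hn' : (n : ℝ) ≠ 0 := by positivity
  unfold expectedPeriodogram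
  simp only [fejer_eq Δ hn, Finset.mul_sum]
  have hi : ∀ s t : ℕ, IntervalIntegrable
      (fun ν => g ν * (Δ / (2 * π * n) * Real.cos (((s : ℝ) - t) * ((ω - ν) * Δ)))) volume
      (-(π / Δ)) (π / Δ) := fun s t => h.integrable.mul_continuousOn (by fun_prop)
  rw [intervalIntegral.integral_finsetSum fun s _ => by
    simpa [Finset.sum_fn] using IntervalIntegrable.sum (Finset.Icc 1 n) fun t _ => hi s t]
  refine Finset.sum_congr rfl fun s _ => ?_
  rw [intervalIntegral.integral_finsetSum fun t _ => hi s t]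
  refine Finset.sum_congr rfl fun t _ => ?_
  have := h.integral_cos_sub ((s : ℤ) - t) ω
  push_cast at this
  have e : ∀ ν, g ν * (Δ / (2 * π * n) * Real.cos (((s : ℝ) - t) * ((ω - ν) * Δ))) =
      Δ / (2 * π * n) * (g ν * Real.cos (((s : ℝ) - t) * ((ω - ν) * Δ))) := fun ν => by ring
  simp only [e]
  rw [intervalIntegral.integral_const_mul, this]
  field_simp

theorem expectedPeriodogram_sub (h : IsAutocovariance Δ g r) (h' : IsAutocovariance Δ g' r')
    {n : ℕ} (hn : 0 < n) (ω : ℝ) :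
    expectedPeriodogram Δ n g ω - expectedPeriodogram Δ n g' ω =
      expectedPeriodogram Δ n (fun ν => g ν - g' ν) ω := by
  rw [h.expectedPeriodogram_eq hn, h'.expectedPeriodogram_eq hn,
    (h.sub h').expectedPeriodogram_eq hn]
  simp only [sub_mul, Finset.sum_sub_distrib, mul_sub]

theorem abs_le (h : IsAutocovariance Δ g r) (hΔ : 0 < Δ) (τ : ℤ) :
    |r τ| ≤ (2 * π)⁻¹ * ∫ ν in (-(π / Δ))..(π / Δ), |g ν| := by
  have hp : -(π / Δ) ≤ π / Δ := by have : 0 < π / Δ := by positivity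
                                   linarith
  have e : r τ = (2 * π)⁻¹ * ∫ ν in (-(π / Δ))..(π / Δ), g ν * Real.cos (τ * (ν * Δ)) := by
    rw [h.integral_cos]; field_simp
  rw [e, abs_mul, abs_of_pos (by positivity : (0 : ℝ) < (2 * π)⁻¹)]
  gcongr
  refine (intervalIntegral.abs_integral_le_integral_abs hp).trans ?_
  refine intervalIntegral.integral_mono_on hp
    (h.integrable.mul_continuousOn (by fun_prop)).abs h.integrable.abs fun ν _ => ?_
  rw [abs_mul]
  exact mul_le_of_le_one_right (abs_nonneg _) (Real.abs_cos_le_one _)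

end IsAutocovariance

theorem continuous_fejer_sub {Δ : ℝ} {n : ℕ} (hn : 0 < n) (ω : ℝ) :
    Continuous fun ν => fejer Δ n (ω - ν) := by
  simp only [fejer_eq Δ hn]
  fun_prop

theorem integral_fejer {Δ : ℝ} (hΔ : 0 < Δ) {n : ℕ} (hn : 0 < n) (ω : ℝ) :
    ∫ ν in (-(π / Δ))..(π / Δ), fejer Δ n (ω - ν) = 1 := by
  have hn' : (n : ℝ) ≠ 0 := by positivity
  simp only [fejer_eq Δ hn]
  rw [intervalIntegral.integral_const_mul, intervalIntegral.integral_finsetSum fun s _ =>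
    (by fun_prop : Continuous _).intervalIntegrable _ _]
  have : ∀ s ∈ Finset.Icc 1 n, ∫ ν in (-(π / Δ))..(π / Δ),
      ∑ t ∈ Finset.Icc 1 n, Real.cos (((s : ℝ) - t) * ((ω - ν) * Δ)) = 2 * π / Δ := by
    intro s hs
    rw [intervalIntegral.integral_finsetSum fun t _ =>
      (by fun_prop : Continuous _).intervalIntegrable _ _]
    have h2 : ∀ t : ℕ, ∫ ν in (-(π / Δ))..(π / Δ), Real.cos (((s : ℝ) - t) * ((ω - ν) * Δ)) =
        if t = s then 2 * π / Δ else 0 := by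
      intro t
      have := integral_cos_period hΔ ((t : ℤ) - s) (((s : ℝ) - t) * (ω * Δ))
      have e : ∀ ν : ℝ, ((s : ℝ) - t) * ((ω - ν) * Δ) =
          (((t : ℤ) - s : ℤ) : ℝ) * (ν * Δ) + ((s : ℝ) - t) * (ω * Δ) := by
        intro ν; push_cast; ring
      simp only [e]
      rw [this]
      by_cases hts : t = s
      · subst hts; simp
      · rw [if_neg (by omega), if_neg hts]
    simp only [h2, Finset.sum_ite_eq', if_pos hs]
  rw [Finset.sum_congr rfl this]
  simp only [Finset.sum_const, Nat.card_Icc, nsmul_eq_mul]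
  simp
  field_simp

/-- Sampled at the Fourier frequencies the Fejér kernel is a partition of unity. -/
theorem sum_fejer {Δ : ℝ} (hΔ : 0 < Δ) {n : ℕ} (hn : 0 < n) (ν : ℝ) :
    ∑ k ∈ fourierIndices n, fejer Δ n (fourierFreq Δ n k - ν) = n * Δ / (2 * π) := by
  have hn' : (n : ℝ) ≠ 0 := by positivity
  simp only [fejer_eq Δ hn]
  rw [← Finset.mul_sum, Finset.sum_comm]
  have : ∀ s ∈ Finset.Icc 1 n, ∑ k ∈ fourierIndices n, ∑ t ∈ Finset.Icc 1 n,
      Real.cos (((s : ℝ) - t) * ((fourierFreq Δ n k - ν) * Δ)) = n := by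
    intro s hs
    rw [Finset.sum_comm]
    have h2 : ∀ t ∈ Finset.Icc 1 n, ∑ k ∈ fourierIndices n,
        Real.cos (((s : ℝ) - t) * ((fourierFreq Δ n k - ν) * Δ)) =
        if t = s then (n : ℝ) else 0 := by
      intro t ht
      have := sum_cos_fourierFreq hΔ hn ((s : ℤ) - t) (-(((s : ℝ) - t) * (ν * Δ)))
      have e : ∀ k : ℤ, ((s : ℝ) - t) * ((fourierFreq Δ n k - ν) * Δ) =
          (((s : ℤ) - t : ℤ) : ℝ) * (fourierFreq Δ n k * Δ) + -(((s : ℝ) - t) * (ν * Δ)) := by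
        intro k; push_cast; ring
      simp only [e]
      rw [this]
      simp only [Finset.mem_Icc] at hs ht
      by_cases hts : t = s
      · subst hts; simp
      · rw [if_neg, if_neg hts]
        intro hd
        have := Int.eq_zero_of_abs_lt_dvd hd (by rw [abs_lt]; omega)
        omega
    rw [Finset.sum_congr rfl h2, Finset.sum_ite_eq', if_pos hs]
  rw [Finset.sum_congr rfl this]
  simp only [Finset.sum_const, Nat.card_Icc, nsmul_eq_mul]
  simp
  field_simp

theorem expectedPeriodogram_mem_Icc {Δ : ℝ} (hΔ : 0 < Δ) {n : ℕ} (hn : 0 < n) {g : ℝ → ℝ}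
    (hg : IntervalIntegrable g volume (-(π / Δ)) (π / Δ)) {m M : ℝ}
    (hb : ∀ ν ∈ Set.Icc (-(π / Δ)) (π / Δ), m ≤ g ν ∧ g ν ≤ M) (ω : ℝ) :
    expectedPeriodogram Δ n g ω ∈ Set.Icc m M := by
  have hp : -(π / Δ) ≤ π / Δ := by
    have : 0 < π / Δ := by positivity
    linarith
  have hc := continuous_fejer_sub (Δ := Δ) hn ω
  have hi := hg.mul_continuousOn (g := fun ν => fejer Δ n (ω - ν)) hc.continuousOn
  have h1 : ∀ c : ℝ, ∫ ν in (-(π / Δ))..(π / Δ), c * fejer Δ n (ω - ν) = c := by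
    intro c
    rw [intervalIntegral.integral_const_mul, integral_fejer hΔ hn, mul_one]
  have h2 : ∀ c : ℝ, IntervalIntegrable (fun ν => c * fejer Δ n (ω - ν)) volume
      (-(π / Δ)) (π / Δ) := fun c => (continuous_const.mul hc).intervalIntegrable _ _
  constructor
  · rw [← h1 m]
    exact intervalIntegral.integral_mono_on hp (h2 m) hi fun ν hν =>
      mul_le_mul_of_nonneg_right (hb ν hν).1 (fejer_nonneg hΔ n _)
  · rw [← h1 M]
    exact intervalIntegral.integral_mono_on hp hi (h2 M) fun ν hν =>
      mul_le_mul_of_nonneg_right (hb ν hν).2 (fejer_nonneg hΔ n _)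

theorem sum_abs_expectedPeriodogram_le {Δ : ℝ} (hΔ : 0 < Δ) {n : ℕ} (hn : 0 < n) {g : ℝ → ℝ}
    (hg : IntervalIntegrable g volume (-(π / Δ)) (π / Δ)) :
    ∑ k ∈ fourierIndices n, |expectedPeriodogram Δ n g (fourierFreq Δ n k)| ≤
      n * Δ / (2 * π) * ∫ ν in (-(π / Δ))..(π / Δ), |g ν| := by
  have hp : -(π / Δ) ≤ π / Δ := by
    have : 0 < π / Δ := by positivity
    linarith
  have hi : ∀ k : ℤ, IntervalIntegrable (fun ν => |g ν| * fejer Δ n (fourierFreq Δ n k - ν)) volume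
      (-(π / Δ)) (π / Δ) := fun k =>
    hg.abs.mul_continuousOn (continuous_fejer_sub (Δ := Δ) hn _).continuousOn
  calc ∑ k ∈ fourierIndices n, |expectedPeriodogram Δ n g (fourierFreq Δ n k)|
      ≤ ∑ k ∈ fourierIndices n,
          ∫ ν in (-(π / Δ))..(π / Δ), |g ν| * fejer Δ n (fourierFreq Δ n k - ν) := by
        refine Finset.sum_le_sum fun k _ => ?_
        refine (intervalIntegral.abs_integral_le_integral_abs hp).trans (le_of_eq ?_)
        simp only [abs_mul, abs_of_nonneg (fejer_nonneg hΔ n _)]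
    _ = ∫ ν in (-(π / Δ))..(π / Δ), n * Δ / (2 * π) * |g ν| := by
        rw [← intervalIntegral.integral_finsetSum fun k _ => hi k]
        simp only [← Finset.mul_sum, sum_fejer hΔ hn]
        simp only [mul_comm]
    _ = _ := intervalIntegral.integral_const_mul _ _

namespace IsAutocovariance

variable {Δ : ℝ} {g g' : ℝ → ℝ} {r r' : ℤ → ℝ}

/-- The sum of squared covariances is `(n / 2πΔ) ∫ g · f̄ₙ`, where `f̄ₙ` is the expected periodogram;
hence it grows at most linearly when `g` is bounded. -/
theorem sum_sum_sq_le (h : IsAutocovariance Δ g r) (hΔ : 0 < Δ) {n : ℕ} (hn : 0 < n) {M : ℝ}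
    (hb : ∀ ν ∈ Set.Icc (-(π / Δ)) (π / Δ), 0 ≤ g ν ∧ g ν ≤ M) :
    ∑ s ∈ Finset.Icc 1 n, ∑ t ∈ Finset.Icc 1 n, r ((s : ℤ) - t) ^ 2 ≤ n * (M / Δ) ^ 2 := by
  have hn' : (n : ℝ) ≠ 0 := by positivity
  have hp : -(π / Δ) ≤ π / Δ := by
    have : 0 < π / Δ := by positivity
    linarith
  have hc : Continuous fun ν => expectedPeriodogram Δ n g ν := by
    simp only [h.expectedPeriodogram_eq hn]; fun_prop
  have hi : ∀ s t : ℕ, IntervalIntegrable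
      (fun ν => r ((s : ℤ) - t) * (g ν * Real.cos (((s : ℝ) - t) * (ν * Δ)))) volume
      (-(π / Δ)) (π / Δ) := fun s t =>
    (h.integrable.mul_continuousOn (by fun_prop)).const_mul _
  have e : ∑ s ∈ Finset.Icc 1 n, ∑ t ∈ Finset.Icc 1 n, r ((s : ℤ) - t) ^ 2 =
      n / (2 * π * Δ) * ∫ ν in (-(π / Δ))..(π / Δ), g ν * expectedPeriodogram Δ n g ν := by
    have e1 : ∀ ν, g ν * expectedPeriodogram Δ n g ν = Δ / n * ∑ s ∈ Finset.Icc 1 n,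
        ∑ t ∈ Finset.Icc 1 n, r ((s : ℤ) - t) * (g ν * Real.cos (((s : ℝ) - t) * (ν * Δ))) := by
      intro ν
      rw [h.expectedPeriodogram_eq hn, mul_left_comm, Finset.mul_sum]
      simp only [Finset.mul_sum, mul_left_comm]
    simp only [e1]
    rw [intervalIntegral.integral_const_mul, intervalIntegral.integral_finsetSum fun s _ => by
      simpa [Finset.sum_fn] using IntervalIntegrable.sum (Finset.Icc 1 n) fun t _ => hi s t, ← mul_assoc, Finset.mul_sum]
    refine Finset.sum_congr rfl fun s _ => ?_
    rw [intervalIntegral.integral_finsetSum fun t _ => hi s t, Finset.mul_sum]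
    refine Finset.sum_congr rfl fun t _ => ?_
    have := h.integral_cos ((s : ℤ) - t)
    push_cast at this
    rw [intervalIntegral.integral_const_mul, this]
    field_simp
  have h1 : ∫ ν in (-(π / Δ))..(π / Δ), g ν * expectedPeriodogram Δ n g ν ≤
      ∫ ν in (-(π / Δ))..(π / Δ), M * M := by
    refine intervalIntegral.integral_mono_on hp (h.integrable.mul_continuousOn hc.continuousOn)
      (by simp) fun ν hν => ?_
    have h2 := expectedPeriodogram_mem_Icc hΔ hn h.integrable hb ν
    have := hb ν hν
    exact mul_le_mul this.2 h2.2 h2.1 (this.1.trans this.2)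
  rw [e]
  calc _ ≤ n / (2 * π * Δ) * ∫ ν in (-(π / Δ))..(π / Δ), M * M := by gcongr
    _ = n * (M / Δ) ^ 2 := by
      rw [intervalIntegral.integral_const, smul_eq_mul]; field_simp; ring

/-- Correlating the expected periodogram with `cos (m · Δ)` over the Fourier frequencies recovers
the covariance at lag `m`, up to the aliased lag `m - n`. -/
theorem sum_expectedPeriodogram_mul_cos (h : IsAutocovariance Δ g r) (hΔ : 0 < Δ) {n : ℕ} {m : ℕ}
    (hm : m < n) :
    ∑ k ∈ fourierIndices n, expectedPeriodogram Δ n g (fourierFreq Δ n k) *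
        Real.cos (m * (fourierFreq Δ n k * Δ)) =
      Δ * ∑ t ∈ Finset.Icc 1 n, if t + m ≤ n then r m else r ((m : ℤ) - n) := by
  have hn : 0 < n := by omega
  have hn' : (n : ℝ) ≠ 0 := by positivity
  -- For each `t` a single `s` in `1, …, n` is congruent to `t + m` modulo `n`.
  have hinner : ∀ t ∈ Finset.Icc 1 n, ∑ s ∈ Finset.Icc 1 n,
      (if (n : ℤ) ∣ (s : ℤ) - t - m then r ((s : ℤ) - t) else 0) =
        if t + m ≤ n then r m else r ((m : ℤ) - n) := by
    intro t ht
    simp only [Finset.mem_Icc] at ht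
    split_ifs with htm
    · rw [Finset.sum_eq_single (t + m)]
      · rw [if_pos (by push_cast; ring_nf; simp)]
        congr 1; push_cast; ring
      · intro s hs hne
        simp only [Finset.mem_Icc] at hs
        rw [if_neg]
        intro hd
        have := Int.eq_zero_of_abs_lt_dvd hd (by rw [abs_lt]; omega)
        omega
      · intro hns; exact absurd (Finset.mem_Icc.2 ⟨by omega, htm⟩) hns
    · rw [Finset.sum_eq_single (t + m - n)]
      · rw [if_pos]
        · congr 1; omega
        · exact ⟨-1, by omega⟩
      · intro s hs hne
        simp only [Finset.mem_Icc] at hs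
        rw [if_neg]
        rintro ⟨q, hq⟩
        have hq1 : (n : ℤ) * q < n * 0 := by rw [← hq]; omega
        have hq2 : (n : ℤ) * (-2) < n * q := by rw [← hq]; omega
        have h1 := lt_of_mul_lt_mul_left hq1 (by positivity)
        have h2 := lt_of_mul_lt_mul_left hq2 (by positivity)
        have : q = -1 := by omega
        subst this
        omega
      · intro hns; exact absurd (Finset.mem_Icc.2 ⟨by omega, by omega⟩) hns
  have hinner' : ∀ s ∈ Finset.Icc 1 n, ∑ t ∈ Finset.Icc 1 n,
      (if (n : ℤ) ∣ (s : ℤ) - t + m then r ((s : ℤ) - t) else 0) =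
        if s + m ≤ n then r m else r ((m : ℤ) - n) := by
    intro s hs
    rw [← hinner s hs]
    refine Finset.sum_congr rfl fun t _ => ?_
    have e1 : (n : ℤ) ∣ (s : ℤ) - t + m ↔ (n : ℤ) ∣ (t : ℤ) - s - m := by
      rw [← dvd_neg]; ring_nf
    have e2 : r ((s : ℤ) - t) = r ((t : ℤ) - s) := by rw [← h.neg]; ring_nf
    simp only [e1, e2]
  have hpair : ∀ s t : ℕ, ∑ k ∈ fourierIndices n, Real.cos (((s : ℝ) - t) *
      (fourierFreq Δ n k * Δ)) * Real.cos (m * (fourierFreq Δ n k * Δ)) =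
      n / 2 * ((if (n : ℤ) ∣ (s : ℤ) - t - m then 1 else 0) +
        (if (n : ℤ) ∣ (s : ℤ) - t + m then 1 else 0)) := by
    intro s t
    have h1 := sum_cos_fourierFreq hΔ hn ((s : ℤ) - t - m) 0
    have h2 := sum_cos_fourierFreq hΔ hn ((s : ℤ) - t + m) 0
    have e : ∀ x : ℝ, Real.cos (((s : ℝ) - t) * x) * Real.cos (m * x) =
        (1 / 2) * (Real.cos ((((s : ℤ) - t - m : ℤ) : ℝ) * x + 0) +
          Real.cos ((((s : ℤ) - t + m : ℤ) : ℝ) * x + 0)) := by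
      intro x
      push_cast
      rw [show ((s : ℝ) - t - m) * x + 0 = (s - t) * x - m * x by ring,
        show ((s : ℝ) - t + m) * x + 0 = (s - t) * x + m * x by ring, Real.cos_sub, Real.cos_add]
      ring
    simp only [e]
    rw [← Finset.mul_sum, Finset.sum_add_distrib, h1, h2, Real.cos_zero]
    split_ifs <;> ring
  have hsum : ∑ k ∈ fourierIndices n, expectedPeriodogram Δ n g (fourierFreq Δ n k) *
        Real.cos (m * (fourierFreq Δ n k * Δ)) =
      Δ / n * ∑ s ∈ Finset.Icc 1 n, ∑ t ∈ Finset.Icc 1 n, r ((s : ℤ) - t) *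
        ∑ k ∈ fourierIndices n, Real.cos (((s : ℝ) - t) *
      (fourierFreq Δ n k * Δ)) * Real.cos (m * (fourierFreq Δ n k * Δ)) := by
    simp only [h.expectedPeriodogram_eq hn, Finset.mul_sum, Finset.sum_mul]
    rw [Finset.sum_comm]
    refine Finset.sum_congr rfl fun s _ => ?_
    rw [Finset.sum_comm]
    refine Finset.sum_congr rfl fun t _ => Finset.sum_congr rfl fun k _ => ?_
    ring
  rw [hsum]
  simp only [hpair]
  have e : ∀ s t : ℕ, r ((s : ℤ) - t) * (n / 2 * ((if (n : ℤ) ∣ (s : ℤ) - t - m then (1 : ℝ) else 0) +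
        (if (n : ℤ) ∣ (s : ℤ) - t + m then 1 else 0))) =
      n / 2 * ((if (n : ℤ) ∣ (s : ℤ) - t - m then r ((s : ℤ) - t) else 0) +
        (if (n : ℤ) ∣ (s : ℤ) - t + m then r ((s : ℤ) - t) else 0)) := by
    intro s t; split_ifs <;> ring
  simp only [e, ← Finset.mul_sum, Finset.sum_add_distrib]
  rw [Finset.sum_congr rfl hinner', Finset.sum_comm, Finset.sum_congr rfl hinner]
  field_simp
  ring

/-- A bounded spectral density is determined by its covariances. -/
theorem ae_eq_of_eq (h : IsAutocovariance Δ g r) (h' : IsAutocovariance Δ g' r) (hΔ : 0 < Δ)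
    {M : ℝ} (hb : ∀ ν ∈ Set.Icc (-(π / Δ)) (π / Δ), |g ν - g' ν| ≤ M) :
    ∀ᵐ ν ∂volume.restrict (Set.Ioc (-(π / Δ)) (π / Δ)), g ν = g' ν := by
  have hp : -(π / Δ) < π / Δ := by
    have : 0 < π / Δ := by positivity
    linarith
  have hs := h.sub h'
  simp only [sub_self] at hs
  set d : ℝ → ℂ := fun ν => ((g ν - g' ν : ℝ) : ℂ) with hd
  have hmeas : AEStronglyMeasurable d (volume.restrict (Set.Ioc (-(π / Δ)) (π / Δ))) :=
    hs.integrable.1.ofReal.aestronglyMeasurable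
  have hmem : MemLp d 2 (volume.restrict (Set.Ioc (-(π / Δ)) (π / Δ))) := by
    refine MemLp.of_bound hmeas M ?_
    filter_upwards [ae_restrict_mem measurableSet_Ioc] with ν hν
    simpa only [hd, Complex.norm_real, Real.norm_eq_abs] using hb ν ⟨hν.1.le, hν.2⟩
  -- All Fourier coefficients of `g - g'` vanish, so Parseval's identity gives `g = g'`.
  have hcoef : ∀ i : ℤ, fourierCoeffOn hp d i = 0 := by
    intro i
    rw [fourierCoeffOn_eq_integral]
    have e : ∀ x : ℝ, fourier (-i) (x : AddCircle (π / Δ - -(π / Δ))) • d x =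
        ((g x - g' x : ℝ) : ℂ) * Complex.exp ((((-i : ℤ) * Δ * x : ℝ) : ℂ) * Complex.I) := by
      intro x
      rw [fourier_coe_apply, smul_eq_mul, mul_comm]
      congr 2
      have hpi : (π : ℂ) ≠ 0 := by exact_mod_cast Real.pi_ne_zero
      have hDC : (Δ : ℂ) ≠ 0 := by exact_mod_cast hΔ.ne'
      push_cast
      field_simp
      ring
    simp only [e]
    rw [integral_mul_exp_of_intervalIntegrable hs.integrable]
    have h4 : ∀ ν : ℝ, ((-i : ℤ) : ℝ) * Δ * ν = (-i : ℤ) * (ν * Δ) := fun ν => by ring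
    simp only [h4, hs.integral_cos (-i), hs.integral_sin (-i)]
    simp
  have hpars := hasSum_sq_fourierCoeffOn hp hmem
  simp only [hcoef, norm_zero, ne_eq, OfNat.ofNat_ne_zero, not_false_eq_true, zero_pow] at hpars
  have h0 := hpars.unique hasSum_zero
  have h1 : ∫ x in (-(π / Δ))..(π / Δ), ‖d x‖ ^ 2 = 0 := by
    have : (π / Δ - -(π / Δ))⁻¹ ≠ 0 := inv_ne_zero (by linarith)
    rw [smul_eq_mul] at h0
    exact (mul_eq_zero.1 h0).resolve_left this
  rw [intervalIntegral.integral_of_le hp.le, integral_eq_zero_iff_of_nonneg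
    (fun x => by positivity) hmem.integrable_norm_pow'] at h1
  filter_upwards [h1] with ν hν
  have : ‖d ν‖ = 0 := by simpa using hν
  rw [hd, Complex.norm_real, norm_eq_zero] at this
  linarith

end IsAutocovariance

/-! ### Second moments of the periodogram fluctuations -/

section Gaussian

variable {Ω ι : Type*} [MeasurableSpace Ω] {P : Measure Ω}

theorem memLp_two_sq_sub_of_hasGaussianLaw {U : Ω → ℝ} (h : HasGaussianLaw U P) (c : ℝ) :
    MemLp (fun w => U w ^ 2 - c) 2 P := by
  have := h.isProbabilityMeasure
  have h4 := h.memLp (p := 4) (by simp)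
  have hi : Integrable (fun w => (U w ^ 2) ^ 2) P := by
    refine (h4.integrable_norm_pow (p := 4) (by norm_num)).congr (.of_forall fun w => ?_)
    simp only [Real.norm_eq_abs, Even.pow_abs (show Even 4 by decide)]
    ring
  exact ((memLp_two_iff_integrable_sq (h4.1.pow 2)).2 hi).sub (memLp_const c)

theorem integral_sq_sub_mul_sq_sub_of_gaussian {U V : Ω → ℝ}
    (h : HasGaussianLaw (fun w => (U w, V w)) P)
    (hU0 : ∫ w, U w ∂P = 0) (hV0 : ∫ w, V w ∂P = 0) :
    ∫ w, (U w ^ 2 - ∫ w', U w' ^ 2 ∂P) * (V w ^ 2 - ∫ w', V w' ^ 2 ∂P) ∂P =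
      2 * (∫ w, U w * V w ∂P) ^ 2 := by
  have := h.isProbabilityMeasure
  set a := ∫ w, U w ^ 2 ∂P
  set b := ∫ w, V w ^ 2 ∂P
  have mU : MemLp (fun w => U w ^ 2) 2 P := by
    simpa using memLp_two_sq_sub_of_hasGaussianLaw h.fst 0
  have mV : MemLp (fun w => V w ^ 2) 2 P := by
    simpa using memLp_two_sq_sub_of_hasGaussianLaw h.snd 0
  have iU := mU.integrable one_le_two
  have iV := mV.integrable one_le_two
  have iUV : Integrable (fun w => U w ^ 2 * V w ^ 2) P := mU.integrable_mul mV
  have e : ∀ w, (U w ^ 2 - a) * (V w ^ 2 - b) =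
      U w ^ 2 * V w ^ 2 - (b * U w ^ 2 + (a * V w ^ 2 - a * b)) := fun w => by ring
  simp only [e]
  have i1 : Integrable (fun w => a * V w ^ 2 - a * b) P :=
    (iV.const_mul a).sub (integrable_const _)
  have i2 : Integrable (fun w => b * U w ^ 2 + (a * V w ^ 2 - a * b)) P :=
    (iU.const_mul b).add i1
  rw [integral_sub iUV i2, integral_add (iU.const_mul b) i1,
    integral_sub (iV.const_mul a) (integrable_const _), integral_const_mul, integral_const_mul,
    integral_const, integral_sq_mul_sq_of_gaussian h hU0 hV0]
  simp only [probReal_univ, one_smul]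
  ring

/-- The variance of a diagonal quadratic form in jointly Gaussian centred variables. -/
theorem integral_sq_sum_mul_sq_sub {Y : ι → Ω → ℝ}
    (hY : ∀ i j, HasGaussianLaw (fun w => (Y i w, Y j w)) P) (h0 : ∀ i, ∫ w, Y i w ∂P = 0)
    (I : Finset ι) (b : ι → ℝ) :
    ∫ w, (∑ i ∈ I, b i * (Y i w ^ 2 - ∫ w', Y i w' ^ 2 ∂P)) ^ 2 ∂P =
      ∑ i ∈ I, ∑ j ∈ I, b i * b j * (2 * (∫ w, Y i w * Y j w ∂P) ^ 2) := by
  have hm : ∀ i, MemLp (fun w => Y i w ^ 2 - ∫ w', Y i w' ^ 2 ∂P) 2 P := fun i =>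
    memLp_two_sq_sub_of_hasGaussianLaw (hY i i).fst _
  have hi : ∀ i j, Integrable (fun w => b i * b j * ((Y i w ^ 2 - ∫ w', Y i w' ^ 2 ∂P) *
      (Y j w ^ 2 - ∫ w', Y j w' ^ 2 ∂P))) P := fun i j =>
    ((hm i).integrable_mul (hm j)).const_mul _
  have e : ∀ w, (∑ i ∈ I, b i * (Y i w ^ 2 - ∫ w', Y i w' ^ 2 ∂P)) ^ 2 =
      ∑ i ∈ I, ∑ j ∈ I, b i * b j * ((Y i w ^ 2 - ∫ w', Y i w' ^ 2 ∂P) *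
        (Y j w ^ 2 - ∫ w', Y j w' ^ 2 ∂P)) := by
    intro w
    rw [pow_two, Finset.sum_mul_sum]
    exact Finset.sum_congr rfl fun i _ => Finset.sum_congr rfl fun j _ => by ring
  simp only [e]
  rw [integral_finsetSum _ fun i _ => integrable_finsetSum _ fun j _ => hi i j]
  refine Finset.sum_congr rfl fun i _ => ?_
  rw [integral_finsetSum _ fun j _ => hi i j]
  refine Finset.sum_congr rfl fun j _ => ?_
  rw [integral_const_mul, integral_sq_sub_mul_sq_sub_of_gaussian (hY i j) (h0 i) (h0 j)]

end Gaussian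

/-- If the rows of `C` satisfy a Bessel inequality with constant `K`, then conjugating a matrix `σ`
by `C` multiplies its Frobenius norm by at most `K`. -/
theorem sum_sum_sq_conj_le {ι κ : Type*} (I : Finset ι) (T : Finset κ) (C : ι → κ → ℝ) {K : ℝ}
    (hK : 0 ≤ K) (hC : ∀ x : κ → ℝ, ∑ i ∈ I, (∑ t ∈ T, C i t * x t) ^ 2 ≤ K * ∑ t ∈ T, x t ^ 2)
    (σ : κ → κ → ℝ) :
    ∑ i ∈ I, ∑ j ∈ I, (∑ s ∈ T, ∑ t ∈ T, C i s * C j t * σ s t) ^ 2 ≤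
      K ^ 2 * ∑ s ∈ T, ∑ t ∈ T, σ s t ^ 2 := by
  calc ∑ i ∈ I, ∑ j ∈ I, (∑ s ∈ T, ∑ t ∈ T, C i s * C j t * σ s t) ^ 2
      = ∑ j ∈ I, ∑ i ∈ I, (∑ s ∈ T, C i s * ∑ t ∈ T, C j t * σ s t) ^ 2 := by
        rw [Finset.sum_comm]
        simp only [Finset.mul_sum, mul_assoc]
    _ ≤ ∑ j ∈ I, K * ∑ s ∈ T, (∑ t ∈ T, C j t * σ s t) ^ 2 :=
        Finset.sum_le_sum fun j _ => hC _
    _ = K * ∑ s ∈ T, ∑ j ∈ I, (∑ t ∈ T, C j t * σ s t) ^ 2 := by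
        rw [← Finset.mul_sum, Finset.sum_comm]
    _ ≤ K * ∑ s ∈ T, K * ∑ t ∈ T, σ s t ^ 2 :=
        mul_le_mul_of_nonneg_left (Finset.sum_le_sum fun s _ => hC _) hK
    _ = K ^ 2 * ∑ s ∈ T, ∑ t ∈ T, σ s t ^ 2 := by
        rw [← Finset.mul_sum]; ring

/-- The coefficients of the cosine (`α = true`) and sine (`α = false`) transforms at the Fourier
frequency of index `k`. -/
noncomputable def trigCoeff (Δ : ℝ) (n : ℕ) (i : ℤ × Bool) (t : ℕ) : ℝ :=
  √(Δ / n) * if i.2 then Real.cos (t * (fourierFreq Δ n i.1 * Δ))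
    else Real.sin (t * (fourierFreq Δ n i.1 * Δ))

/-- The periodogram is the sum of squares of the cosine and sine transforms. -/
theorem periodogram_eq (Δ : ℝ) (n : ℕ) (x : ℤ → ℝ) (k : ℤ) :
    periodogram Δ n x (fourierFreq Δ n k) =
      ∑ α : Bool, (∑ t ∈ Finset.Icc 1 n, trigCoeff Δ n (k, α) t * x t) ^ 2 := by
  unfold periodogram dft
  have e : ∀ t : ℕ, (x (t : ℤ) : ℂ) * Complex.exp (-(Complex.I * fourierFreq Δ n k * t * Δ)) =
      ((x t * Real.cos (t * (fourierFreq Δ n k * Δ)) : ℝ) : ℂ) -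
        ((x t * Real.sin (t * (fourierFreq Δ n k * Δ)) : ℝ) : ℂ) * Complex.I := by
    intro t
    have : -(Complex.I * fourierFreq Δ n k * t * Δ) =
        ((-(t * (fourierFreq Δ n k * Δ)) : ℝ) : ℂ) * Complex.I := by push_cast; ring
    rw [this, Complex.exp_mul_I, ← Complex.ofReal_cos, ← Complex.ofReal_sin, Real.cos_neg,
      Real.sin_neg]
    push_cast
    ring
  simp only [e, Finset.sum_sub_distrib, ← Finset.sum_mul, ← Complex.ofReal_sum]
  rw [norm_mul, Complex.norm_real, mul_pow, ← Complex.normSq_eq_norm_sq, sub_eq_add_neg,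
    ← neg_mul, ← Complex.ofReal_neg, Complex.normSq_add_mul_I, Fintype.sum_bool, Real.norm_eq_abs,
    sq_abs]
  simp only [trigCoeff, if_true, Bool.false_eq_true, if_false, mul_assoc, ← Finset.mul_sum]
  simp only [mul_comm (x _)]
  ring

theorem sum_bool_trigCoeff_mul (Δ : ℝ) (hΔ : 0 < Δ) (n : ℕ) (k : ℤ) (s t : ℕ) :
    ∑ α : Bool, trigCoeff Δ n (k, α) s * trigCoeff Δ n (k, α) t =
      Δ / n * Real.cos (((s : ℝ) - t) * (fourierFreq Δ n k * Δ)) := by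
  have h : √(Δ / n) * √(Δ / n) = Δ / n := Real.mul_self_sqrt (by positivity)
  simp only [trigCoeff, Fintype.sum_bool, if_true, Bool.false_eq_true, if_false]
  rw [sub_mul, Real.cos_sub]
  linear_combination (Real.cos (s * (fourierFreq Δ n k * Δ)) *
    Real.cos (t * (fourierFreq Δ n k * Δ)) + Real.sin (s * (fourierFreq Δ n k * Δ)) *
    Real.sin (t * (fourierFreq Δ n k * Δ))) * h

/-- Parseval's identity for the discrete Fourier transform. -/
theorem sum_trigCoeff_sq {Δ : ℝ} (hΔ : 0 < Δ) {n : ℕ} (hn : 0 < n) (x : ℕ → ℝ) :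
    ∑ i ∈ fourierIndices n ×ˢ Finset.univ, (∑ t ∈ Finset.Icc 1 n, trigCoeff Δ n i t * x t) ^ 2 =
      Δ * ∑ t ∈ Finset.Icc 1 n, x t ^ 2 := by
  have hn' : (n : ℝ) ≠ 0 := by positivity
  rw [Finset.sum_product]
  have e : ∀ k : ℤ, ∑ α : Bool, (∑ t ∈ Finset.Icc 1 n, trigCoeff Δ n (k, α) t * x t) ^ 2 =
      ∑ s ∈ Finset.Icc 1 n, ∑ t ∈ Finset.Icc 1 n, x s * x t *
        (Δ / n * Real.cos (((s : ℝ) - t) * (fourierFreq Δ n k * Δ))) := by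
    intro k
    simp only [pow_two, Finset.sum_mul_sum]
    rw [Finset.sum_comm]
    refine Finset.sum_congr rfl fun s _ => ?_
    rw [Finset.sum_comm]
    refine Finset.sum_congr rfl fun t _ => ?_
    rw [← sum_bool_trigCoeff_mul Δ hΔ, Finset.mul_sum]
    exact Finset.sum_congr rfl fun α _ => by ring
  simp only [e]
  rw [Finset.sum_comm, Finset.mul_sum]
  refine Finset.sum_congr rfl fun s hs => ?_
  rw [Finset.sum_comm]
  have h2 : ∀ t ∈ Finset.Icc 1 n, ∑ k ∈ fourierIndices n,
      x s * x t * (Δ / n * Real.cos (((s : ℝ) - t) * (fourierFreq Δ n k * Δ))) =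
      if t = s then Δ * x s ^ 2 else 0 := by
    intro t ht
    have h3 := sum_cos_fourierFreq hΔ hn ((s : ℤ) - t) 0
    push_cast at h3
    simp only [add_zero] at h3
    rw [← Finset.mul_sum, ← Finset.mul_sum, h3]
    simp only [Finset.mem_Icc] at hs ht
    by_cases hts : t = s
    · subst hts; simp; field_simp
    · rw [if_neg, if_neg hts, mul_zero, mul_zero]
      intro hd
      have := Int.eq_zero_of_abs_lt_dvd hd (by rw [abs_lt]; omega)
      omega
  rw [Finset.sum_congr rfl h2, Finset.sum_ite_eq', if_pos hs]

/-- Bounds on the fluctuations `Iₙ - E Iₙ` of the periodogram of a Gaussian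
stationary sequence: weighted sums over the Fourier frequencies have variance `O(n)`. -/
theorem periodogram_fluctuation {Ω : Type*} [MeasurableSpace Ω] {P : Measure Ω}
    {Y : ℤ → Ω → ℝ} {Δ : ℝ} (hΔ : 0 < Δ) {g : ℝ → ℝ} (h : HasSpectralDensity P Y Δ g)
    (hgauss : IsGaussianProcess Y P) {M : ℝ}
    (hb : ∀ ν ∈ Set.Icc (-(π / Δ)) (π / Δ), 0 ≤ g ν ∧ g ν ≤ M) {n : ℕ} (hn : 0 < n)
    (N : ℤ → Ω → ℝ) (hN : ∀ k w, N k w =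
      periodogram Δ n (fun t => Y t w) (fourierFreq Δ n k) -
        expectedPeriodogram Δ n g (fourierFreq Δ n k)) :
    (∀ k, MemLp (N k) 2 P) ∧
    (∀ (b : ℤ → ℝ) (B : ℝ), (∀ k ∈ fourierIndices n, |b k| ≤ B) →
      ∫ w, (∑ k ∈ fourierIndices n, b k * N k w) ^ 2 ∂P ≤ 2 * M ^ 2 * B ^ 2 * n) ∧
    ∑ k ∈ fourierIndices n, ∫ w, N k w ^ 2 ∂P ≤ 2 * M ^ 2 * n := by
  classical
  set r : ℤ → ℝ := fun τ => ∫ w, Y τ w * Y 0 w ∂P with hr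
  have hac : IsAutocovariance Δ g r := h.isAutocovariance
  set Z : ℤ × Bool → Ω → ℝ := fun i w => ∑ t ∈ Finset.Icc 1 n, trigCoeff Δ n i t * Y t w with hZ
  have hZZ : ∀ i j, ∫ w, Z i w * Z j w ∂P = ∑ s ∈ Finset.Icc 1 n, ∑ t ∈ Finset.Icc 1 n,
      trigCoeff Δ n i s * trigCoeff Δ n j t * r ((s : ℤ) - t) := by
    intro i j
    have hi : ∀ s t : ℕ, Integrable (fun w => trigCoeff Δ n i s * trigCoeff Δ n j t *
        (Y s w * Y t w)) P := fun s t =>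
      ((h.memLp s).integrable_mul (h.memLp t)).const_mul _
    have e : ∀ w, Z i w * Z j w = ∑ s ∈ Finset.Icc 1 n, ∑ t ∈ Finset.Icc 1 n,
        trigCoeff Δ n i s * trigCoeff Δ n j t * (Y s w * Y t w) := by
      intro w
      simp only [hZ, Finset.sum_mul_sum]
      exact Finset.sum_congr rfl fun s _ => Finset.sum_congr rfl fun t _ => by ring
    simp only [e]
    rw [integral_finsetSum _ fun s _ => integrable_finsetSum _ fun t _ => hi s t]
    refine Finset.sum_congr rfl fun s _ => ?_
    rw [integral_finsetSum _ fun t _ => hi s t]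
    refine Finset.sum_congr rfl fun t _ => ?_
    rw [integral_const_mul, h.integral_mul_eq]
  have hgaussZ : ∀ i j, HasGaussianLaw (fun w => (Z i w, Z j w)) P := by
    have : IsGaussianProcess Z P := by
      refine hgauss.of_isGaussianProcess fun i => ⟨(Finset.Icc 1 n).image (fun t : ℕ => (t : ℤ)),
        ∑ t : (Finset.Icc 1 n), trigCoeff Δ n i t • ContinuousLinearMap.proj
          (⟨((t : ℕ) : ℤ), Finset.mem_image_of_mem _ t.2⟩ :
            ((Finset.Icc 1 n).image (fun t : ℕ => (t : ℤ)))), fun w => ?_⟩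
      simp only [hZ, sum_apply, smul_apply,
        ContinuousLinearMap.proj_apply, smul_eq_mul, Finset.restrict]
      rw [← Finset.sum_attach]
      rfl
    intro i j
    exact this.hasGaussianLaw_prodMk
  have hZ0 : ∀ i, ∫ w, Z i w ∂P = 0 := by
    intro i
    have := hgauss.isProbabilityMeasure
    simp only [hZ]
    rw [integral_finsetSum _ fun (t : ℕ) _ =>
      ((h.memLp (t : ℤ)).integrable one_le_two).const_mul _]
    simp [integral_const_mul, h.mean_zero]
  have hNZ : ∀ k w, N k w = ∑ α : Bool, (Z (k, α) w ^ 2 - ∫ w', Z (k, α) w' ^ 2 ∂P) := by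
    intro k w
    rw [hN, periodogram_eq, Finset.sum_sub_distrib]
    congr 1
    simp only [pow_two (Z _ _), hZZ]
    rw [hac.expectedPeriodogram_eq hn, Finset.mul_sum, Finset.sum_comm (s := Finset.univ)]
    refine Finset.sum_congr rfl fun s _ => ?_
    rw [Finset.mul_sum, Finset.sum_comm (s := Finset.univ)]
    refine Finset.sum_congr rfl fun t _ => ?_
    rw [← Finset.sum_mul, sum_bool_trigCoeff_mul Δ hΔ]
    ring
  have htot : ∑ i ∈ fourierIndices n ×ˢ Finset.univ, ∑ j ∈ fourierIndices n ×ˢ Finset.univ,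
      (∫ w, Z i w * Z j w ∂P) ^ 2 ≤ M ^ 2 * n := by
    simp only [hZZ]
    refine (sum_sum_sq_conj_le _ _ _ hΔ.le (fun x => (sum_trigCoeff_sq hΔ hn x).le) _).trans ?_
    calc Δ ^ 2 * ∑ s ∈ Finset.Icc 1 n, ∑ t ∈ Finset.Icc 1 n, r ((s : ℤ) - t) ^ 2
        ≤ Δ ^ 2 * (n * (M / Δ) ^ 2) := by
          gcongr
          exact hac.sum_sum_sq_le hΔ hn hb
      _ = M ^ 2 * n := by field_simp
  refine ⟨fun k => ?_, fun b B hB => ?_, ?_⟩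
  · have : N k = fun w => ∑ α : Bool, (Z (k, α) w ^ 2 - ∫ w', Z (k, α) w' ^ 2 ∂P) :=
      funext (hNZ k)
    rw [this]
    exact memLp_finsetSum _ fun α _ =>
      memLp_two_sq_sub_of_hasGaussianLaw (hgaussZ (k, α) (k, α)).fst _
  · have e : ∀ w, ∑ k ∈ fourierIndices n, b k * N k w =
        ∑ i ∈ fourierIndices n ×ˢ Finset.univ, b i.1 * (Z i w ^ 2 - ∫ w', Z i w' ^ 2 ∂P) := by
      intro w
      rw [Finset.sum_product]
      exact Finset.sum_congr rfl fun k _ => by rw [hNZ, Finset.mul_sum]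
    simp only [e]
    rw [integral_sq_sum_mul_sq_sub hgaussZ hZ0]
    calc _ ≤ ∑ i ∈ fourierIndices n ×ˢ Finset.univ, ∑ j ∈ fourierIndices n ×ˢ Finset.univ,
          2 * B ^ 2 * (∫ w, Z i w * Z j w ∂P) ^ 2 := by
          refine Finset.sum_le_sum fun i hi => Finset.sum_le_sum fun j hj => ?_
          have h1 := hB _ (Finset.mem_product.1 hi).1
          have h2 := hB _ (Finset.mem_product.1 hj).1
          have h3 : b i.1 * b j.1 ≤ B ^ 2 := by
            calc b i.1 * b j.1 ≤ |b i.1 * b j.1| := le_abs_self _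
              _ = |b i.1| * |b j.1| := abs_mul _ _
              _ ≤ B * B := mul_le_mul h1 h2 (abs_nonneg _) ((abs_nonneg _).trans h1)
              _ = B ^ 2 := by ring
          nlinarith [sq_nonneg (∫ w, Z i w * Z j w ∂P)]
      _ ≤ 2 * B ^ 2 * (M ^ 2 * n) := by
          simp only [← Finset.mul_sum]
          gcongr
      _ = 2 * M ^ 2 * B ^ 2 * n := by ring
  · have e : ∀ k, ∫ w, N k w ^ 2 ∂P = ∑ α : Bool, ∑ β : Bool,
        2 * (∫ w, Z (k, α) w * Z (k, β) w ∂P) ^ 2 := by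
      intro k
      have := integral_sq_sum_mul_sq_sub (Y := fun α : Bool => Z (k, α))
        (fun α β => hgaussZ _ _) (fun α => hZ0 _) Finset.univ (fun _ => 1)
      simp only [one_mul] at this
      rw [← this]
      simp only [hNZ]
    simp only [e]
    calc _ ≤ ∑ k ∈ fourierIndices n, ∑ α : Bool, ∑ l ∈ fourierIndices n, ∑ β : Bool,
          2 * (∫ w, Z (k, α) w * Z (l, β) w ∂P) ^ 2 := by
          refine Finset.sum_le_sum fun k hk => Finset.sum_le_sum fun α _ => ?_
          exact Finset.single_le_sum (f := fun l => ∑ β : Bool,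
            2 * (∫ w, Z (k, α) w * Z (l, β) w ∂P) ^ 2)
            (fun l _ => Finset.sum_nonneg fun β _ => by positivity) hk
      _ = 2 * ∑ i ∈ fourierIndices n ×ˢ Finset.univ, ∑ j ∈ fourierIndices n ×ˢ Finset.univ,
          (∫ w, Z i w * Z j w ∂P) ^ 2 := by
          simp only [Finset.sum_product, Finset.mul_sum]
      _ ≤ 2 * M ^ 2 * n := by linarith

/-! ### Aliasing, and compactness of the parametric family -/

/-- Finitely many members of a family of continuous functions without common zero on a compact set
suffice to keep the family bounded away from zero. -/
theorem exists_finset_forall_le_abs {α ι : Type*} [TopologicalSpace α] {S : Set α}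
    (hS : IsCompact S) {φ : ι → α → ℝ} (hφ : ∀ i, ContinuousOn (φ i) S)
    (h0 : ∀ x ∈ S, ∃ i, φ i x ≠ 0) :
    ∃ T : Finset ι, ∃ c : ℝ, 0 < c ∧ ∀ x ∈ S, ∃ i ∈ T, c ≤ |φ i x| := by
  classical
  refine hS.induction_on (p := fun s => ∃ T : Finset ι, ∃ c : ℝ, 0 < c ∧
    ∀ x ∈ s, ∃ i ∈ T, c ≤ |φ i x|) ⟨∅, 1, one_pos, by simp⟩ ?_ ?_ ?_
  · rintro s t hst ⟨T, c, hc, h⟩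
    exact ⟨T, c, hc, fun x hx => h x (hst hx)⟩
  · rintro s t ⟨T, c, hc, h⟩ ⟨T', c', hc', h'⟩
    refine ⟨T ∪ T', min c c', lt_min hc hc', ?_⟩
    rintro x (hx | hx)
    · obtain ⟨i, hi, hle⟩ := h x hx
      exact ⟨i, Finset.mem_union_left _ hi, (min_le_left _ _).trans hle⟩
    · obtain ⟨i, hi, hle⟩ := h' x hx
      exact ⟨i, Finset.mem_union_right _ hi, (min_le_right _ _).trans hle⟩
  · intro x hx
    obtain ⟨i, hi⟩ := h0 x hx
    have hlt : |φ i x| / 2 < |φ i x| := half_lt_self (abs_pos.2 hi)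
    have hev := (hφ i x hx).abs.eventually_const_lt hlt
    exact ⟨_, hev, {i}, |φ i x| / 2, half_pos (abs_pos.2 hi),
      fun y hy => ⟨i, Finset.mem_singleton_self i, le_of_lt hy⟩⟩

namespace IsAutocovariance

variable {Δ : ℝ} {g : ℝ → ℝ} {r : ℤ → ℝ}

/-- The aliasing error: of the `n` terms that recover the covariance at lag `m`, exactly `m` carry the
lag `m - n` instead. -/
theorem mul_abs_le_sum_add (h : IsAutocovariance Δ g r) (hΔ : 0 < Δ) {K : ℝ}
    (hK : ∀ τ, |r τ| ≤ K) {m n : ℕ} (hm : m < n) :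
    n * (Δ * |r m|) ≤
      ∑ k ∈ fourierIndices n, |expectedPeriodogram Δ n g (fourierFreq Δ n k)| + 2 * K * Δ * m := by
  have hK0 : 0 ≤ K := (abs_nonneg _).trans (hK 0)
  have h1 := h.sum_expectedPeriodogram_mul_cos hΔ hm
  set A := ∑ t ∈ Finset.Icc 1 n, if t + m ≤ n then r m else r ((m : ℤ) - n) with hA
  have h2 : |Δ * A| ≤
      ∑ k ∈ fourierIndices n, |expectedPeriodogram Δ n g (fourierFreq Δ n k)| := by
    rw [← h1]
    refine (Finset.abs_sum_le_sum_abs _ _).trans (Finset.sum_le_sum fun k _ => ?_)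
    rw [abs_mul]
    exact mul_le_of_le_one_right (abs_nonneg _) (Real.abs_cos_le_one _)
  have h3 : |A - n * r m| ≤ 2 * K * m := by
    have e : A - n * r m = ∑ t ∈ Finset.Icc 1 n,
        ((if t + m ≤ n then r m else r ((m : ℤ) - n)) - r m) := by
      rw [Finset.sum_sub_distrib, ← hA]; simp
    rw [e]
    calc _ ≤ ∑ t ∈ Finset.Icc 1 n, |(if t + m ≤ n then r m else r ((m : ℤ) - n)) - r m| :=
          Finset.abs_sum_le_sum_abs _ _
      _ ≤ ∑ t ∈ Finset.Icc 1 n, if t + m ≤ n then 0 else 2 * K := by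
          refine Finset.sum_le_sum fun t _ => ?_
          split_ifs
          · simp
          · calc _ ≤ |r ((m : ℤ) - n)| + |r m| := abs_sub _ _
              _ ≤ 2 * K := by linarith [hK ((m : ℤ) - n), hK m]
      _ = ((Finset.Icc 1 n).filter fun t => ¬ t + m ≤ n).card * (2 * K) := by
          rw [Finset.sum_ite]; simp
      _ ≤ m * (2 * K) := by
          gcongr
          calc _ ≤ (Finset.Ioc (n - m) n).card := by
                refine Finset.card_le_card fun t ht => ?_
                simp only [Finset.mem_filter, Finset.mem_Icc] at ht
                simp only [Finset.mem_Ioc]; omega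
            _ = m := by simp; omega
      _ = 2 * K * m := by ring
  have h4 : n * |r m| ≤ |A| + 2 * K * m := by
    have : |(n : ℝ) * r m| = n * |r m| := by rw [abs_mul, Nat.abs_cast]
    rw [← this]
    have := abs_sub_abs_le_abs_sub (n * r m) A
    rw [abs_sub_comm] at this
    linarith
  rw [abs_mul, abs_of_pos hΔ] at h2
  nlinarith

/-- Letting `n → ∞` removes the aliasing error: covariances are bounded by expected
periodograms. -/
theorem mul_abs_le_of_forall (h : IsAutocovariance Δ g r) (hΔ : 0 < Δ) {L : ℝ}
    (hL : ∀ n : ℕ, 0 < n → ∀ k ∈ fourierIndices n,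
      |expectedPeriodogram Δ n g (fourierFreq Δ n k)| ≤ L) (τ : ℤ) : Δ * |r τ| ≤ L := by
  have key : ∀ m : ℕ, Δ * |r m| ≤ L := by
    intro m
    set K := (2 * π)⁻¹ * ∫ ν in (-(π / Δ))..(π / Δ), |g ν|
    have hlim : Tendsto (fun n : ℕ => L + 2 * K * Δ * m / (n : ℝ)) atTop (nhds (L + 0)) :=
      tendsto_const_nhds.add (tendsto_const_div_atTop_nhds_zero_nat _)
    rw [add_zero] at hlim
    refine ge_of_tendsto hlim ?_
    filter_upwards [eventually_gt_atTop m] with n hn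
    have hn0 : (0 : ℝ) < n := by exact_mod_cast (by omega : 0 < n)
    have h1 := h.mul_abs_le_sum_add hΔ (h.abs_le hΔ) hn
    have h2 : ∑ k ∈ fourierIndices n, |expectedPeriodogram Δ n g (fourierFreq Δ n k)| ≤ n * L := by
      have := Finset.sum_le_card_nsmul _ _ _ (hL n (by omega))
      rwa [card_fourierIndices, nsmul_eq_mul] at this
    have : n * (Δ * |r m|) ≤ n * (L + 2 * K * Δ * m / n) := by
      rw [mul_add, mul_div_cancel₀ _ hn0.ne']; linarith
    exact le_of_mul_le_mul_left this hn0
  obtain ⟨m, rfl | rfl⟩ := τ.eq_nat_or_neg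
  · exact key m
  · rw [h.neg]; exact key m

theorem exists_abs_expectedPeriodogram_le (h : IsAutocovariance Δ g r) (hΔ : 0 < Δ) {n : ℕ}
    (hn : 0 < n) (ω : ℝ) :
    ∃ m : ℕ, m < n ∧ |expectedPeriodogram Δ n g ω| ≤ Δ * n * |r m| := by
  have hn0 : (0 : ℝ) < n := by exact_mod_cast hn
  obtain ⟨m, hm, hmax⟩ := Finset.exists_max_image (Finset.range n) (fun m : ℕ => |r m|)
    ⟨0, Finset.mem_range.2 hn⟩
  refine ⟨m, Finset.mem_range.1 hm, ?_⟩
  rw [h.expectedPeriodogram_eq hn, abs_mul, abs_of_pos (div_pos hΔ hn0)]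
  have hb : ∀ s ∈ Finset.Icc 1 n, ∀ t ∈ Finset.Icc 1 n,
      |r ((s : ℤ) - t) * Real.cos (((s : ℝ) - t) * (ω * Δ))| ≤ |r m| := by
    intro s hs t ht
    simp only [Finset.mem_Icc] at hs ht
    rw [abs_mul]
    refine (mul_le_of_le_one_right (abs_nonneg _) (Real.abs_cos_le_one _)).trans ?_
    obtain ⟨q, hq | hq⟩ := ((s : ℤ) - t).eq_nat_or_neg
    · rw [hq]; exact hmax q (Finset.mem_range.2 (by omega))
    · rw [hq, h.neg]; exact hmax q (Finset.mem_range.2 (by omega))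
  have h1 : |∑ s ∈ Finset.Icc 1 n, ∑ t ∈ Finset.Icc 1 n,
      r ((s : ℤ) - t) * Real.cos (((s : ℝ) - t) * (ω * Δ))| ≤ n * (n * |r m|) := by
    calc _ ≤ ∑ s ∈ Finset.Icc 1 n, |∑ t ∈ Finset.Icc 1 n,
          r ((s : ℤ) - t) * Real.cos (((s : ℝ) - t) * (ω * Δ))| := Finset.abs_sum_le_sum_abs _ _
      _ ≤ ∑ s ∈ Finset.Icc 1 n, ∑ t ∈ Finset.Icc 1 n, |r m| :=
          Finset.sum_le_sum fun s hs => (Finset.abs_sum_le_sum_abs _ _).trans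
            (Finset.sum_le_sum fun t ht => hb s hs t ht)
      _ = n * (n * |r m|) := by simp
  calc _ ≤ Δ / n * (n * (n * |r m|)) := by gcongr
    _ = Δ * n * |r m| := by field_simp

end IsAutocovariance

section Family

variable {E : Type*} {Δ : ℝ} {f : ℝ → E → ℝ} {Θ : Set E} {r : E → ℤ → ℝ} {fmin fmax : ℝ}

theorem abs_sub_le_of_bound (hfmin : 0 < fmin)
    (hbound : ∀ γ ∈ Θ, ∀ ω ∈ Set.Icc (-(π / Δ)) (π / Δ), fmin ≤ f ω γ ∧ f ω γ ≤ fmax)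
    {γ γ' : E} (hγ : γ ∈ Θ) (hγ' : γ' ∈ Θ) {ω : ℝ} (hω : ω ∈ Set.Icc (-(π / Δ)) (π / Δ)) :
    |f ω γ - f ω γ'| ≤ fmax := by
  have h1 := hbound γ hγ ω hω
  have h2 := hbound γ' hγ' ω hω
  rw [abs_le]; constructor <;> linarith

/-- By dominated convergence the spectral densities depend continuously on the parameter in
`L¹`. -/
theorem tendsto_integral_abs_sub [TopologicalSpace E] [FirstCountableTopology E] (hΔ : 0 < Δ)
    (hfmin : 0 < fmin)
    (hbound : ∀ γ ∈ Θ, ∀ ω ∈ Set.Icc (-(π / Δ)) (π / Δ), fmin ≤ f ω γ ∧ f ω γ ≤ fmax)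
    (hint : ∀ γ ∈ Θ, IntervalIntegrable (fun ω => f ω γ) volume (-(π / Δ)) (π / Δ))
    (hcont : ∀ ω ∈ Set.Icc (-(π / Δ)) (π / Δ), ContinuousOn (fun γ => f ω γ) Θ)
    {γ₀ : E} (hγ₀ : γ₀ ∈ Θ) :
    Tendsto (fun γ => ∫ ν in (-(π / Δ))..(π / Δ), |f ν γ - f ν γ₀|) (nhdsWithin γ₀ Θ)
      (nhds 0) := by
  have hp : -(π / Δ) ≤ π / Δ := by
    have : 0 < π / Δ := by positivity
    linarith
  have := intervalIntegral.tendsto_integral_filter_of_dominated_convergence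
    (μ := volume) (a := -(π / Δ)) (b := π / Δ) (l := nhdsWithin γ₀ Θ)
    (F := fun γ ν => |f ν γ - f ν γ₀|) (f := fun _ => 0) (fun _ => fmax) ?_ ?_ (by simp) ?_
  · simpa using this
  · filter_upwards [self_mem_nhdsWithin] with γ hγ
    rw [Set.uIoc_of_le hp]
    exact ((hint γ hγ).sub (hint γ₀ hγ₀)).abs.1.aestronglyMeasurable
  · filter_upwards [self_mem_nhdsWithin] with γ hγ
    refine .of_forall fun ν hν => ?_
    rw [Set.uIoc_of_le hp] at hν
    rw [Real.norm_eq_abs, abs_abs]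
    exact abs_sub_le_of_bound hfmin hbound hγ hγ₀ ⟨hν.1.le, hν.2⟩
  · refine .of_forall fun ν hν => ?_
    rw [Set.uIoc_of_le hp] at hν
    have h1 : Tendsto (fun γ => f ν γ) (nhdsWithin γ₀ Θ) (nhds (f ν γ₀)) :=
      hcont ν ⟨hν.1.le, hν.2⟩ γ₀ hγ₀
    simpa using (h1.sub_const (f ν γ₀)).abs

theorem continuousOn_autocovariance [TopologicalSpace E] [FirstCountableTopology E] (hΔ : 0 < Δ)
    (hfmin : 0 < fmin)
    (hbound : ∀ γ ∈ Θ, ∀ ω ∈ Set.Icc (-(π / Δ)) (π / Δ), fmin ≤ f ω γ ∧ f ω γ ≤ fmax)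
    (hr : ∀ γ ∈ Θ, IsAutocovariance Δ (fun ω => f ω γ) (r γ))
    (hcont : ∀ ω ∈ Set.Icc (-(π / Δ)) (π / Δ), ContinuousOn (fun γ => f ω γ) Θ) (τ : ℤ) :
    ContinuousOn (fun γ => r γ τ) Θ := by
  intro γ₀ hγ₀
  have h1 := (tendsto_integral_abs_sub hΔ hfmin hbound (fun γ hγ => (hr γ hγ).integrable) hcont
    hγ₀).const_mul (2 * π)⁻¹
  rw [mul_zero] at h1
  rw [ContinuousWithinAt, tendsto_iff_dist_tendsto_zero]
  refine squeeze_zero' (.of_forall fun _ => dist_nonneg) ?_ h1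
  filter_upwards [self_mem_nhdsWithin] with γ hγ
  rw [Real.dist_eq]
  exact ((hr γ hγ).sub (hr γ₀ hγ₀)).abs_le hΔ τ

/-- Total boundedness of the family of expected periodograms, in mean square over the Fourier
frequencies and uniformly in `n`. -/
theorem exists_finset_sum_sq_sub_le [TopologicalSpace E] [FirstCountableTopology E] (hΔ : 0 < Δ)
    (hfmin : 0 < fmin) (hΘ : IsCompact Θ)
    (hbound : ∀ γ ∈ Θ, ∀ ω ∈ Set.Icc (-(π / Δ)) (π / Δ), fmin ≤ f ω γ ∧ f ω γ ≤ fmax)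
    (hr : ∀ γ ∈ Θ, IsAutocovariance Δ (fun ω => f ω γ) (r γ))
    (hcont : ∀ ω ∈ Set.Icc (-(π / Δ)) (π / Δ), ContinuousOn (fun γ => f ω γ) Θ)
    {η : ℝ} (hη : 0 < η) :
    ∃ Γ : Finset E, (↑Γ : Set E) ⊆ Θ ∧ ∀ γ ∈ Θ, ∃ γ' ∈ Γ, ∀ n : ℕ, 0 < n →
      ∑ k ∈ fourierIndices n,
        (expectedPeriodogram Δ n (fun ν => f ν γ) (fourierFreq Δ n k) -
          expectedPeriodogram Δ n (fun ν => f ν γ') (fourierFreq Δ n k)) ^ 2 ≤ η * n := by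
  classical
  refine (hΘ.induction_on (p := fun s => ∃ Γ : Finset E, (↑Γ : Set E) ⊆ Θ ∧
    ∀ γ ∈ s, γ ∈ Θ → ∃ γ' ∈ Γ, ∀ n : ℕ, 0 < n → ∑ k ∈ fourierIndices n,
        (expectedPeriodogram Δ n (fun ν => f ν γ) (fourierFreq Δ n k) -
          expectedPeriodogram Δ n (fun ν => f ν γ') (fourierFreq Δ n k)) ^ 2 ≤ η * n)
    ⟨∅, by simp⟩ ?_ ?_ ?_).imp fun Γ h => ⟨h.1, fun γ hγ => h.2 γ hγ hγ⟩
  · rintro s t hst ⟨Γ, hΓ, h⟩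
    exact ⟨Γ, hΓ, fun γ hγ => h γ (hst hγ)⟩
  · rintro s t ⟨Γ, hΓ, h⟩ ⟨Γ', hΓ', h'⟩
    refine ⟨Γ ∪ Γ', by simp [hΓ, hΓ'], ?_⟩
    rintro γ (hγ | hγ) hγΘ
    · obtain ⟨γ', hi, hle⟩ := h γ hγ hγΘ
      exact ⟨γ', Finset.mem_union_left _ hi, hle⟩
    · obtain ⟨γ', hi, hle⟩ := h' γ hγ hγΘ
      exact ⟨γ', Finset.mem_union_right _ hi, hle⟩
  · intro γ₀ hγ₀
    have hF : 0 < fmax := by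
      have hp : 0 < π / Δ := by positivity
      have := hbound γ₀ hγ₀ 0 ⟨by linarith, hp.le⟩
      linarith
    have hev := (tendsto_integral_abs_sub hΔ hfmin hbound
      (fun γ hγ => (hr γ hγ).integrable) hcont hγ₀).eventually_lt_const
        (show 0 < η / (fmax * (Δ / (2 * π))) by positivity)
    refine ⟨_, hev, {γ₀}, by simpa using hγ₀, fun γ hγ hγΘ => ⟨γ₀, by simp, fun n hn => ?_⟩⟩
    have hlt : ∫ ν in (-(π / Δ))..(π / Δ), |f ν γ - f ν γ₀| < η / (fmax * (Δ / (2 * π))) := hγ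
    have hd : ∀ k, |expectedPeriodogram Δ n (fun ν => f ν γ - f ν γ₀) (fourierFreq Δ n k)| ≤
        fmax := by
      intro k
      rw [abs_le]
      exact expectedPeriodogram_mem_Icc hΔ hn ((hr γ hγΘ).sub (hr γ₀ hγ₀)).integrable
        (fun ν hν => abs_le.1 (abs_sub_le_of_bound hfmin hbound hγΘ hγ₀ hν)) _
    simp only [(hr γ hγΘ).expectedPeriodogram_sub (hr γ₀ hγ₀) hn]
    calc _ ≤ ∑ k ∈ fourierIndices n, fmax *
          |expectedPeriodogram Δ n (fun ν => f ν γ - f ν γ₀) (fourierFreq Δ n k)| := by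
          refine Finset.sum_le_sum fun k _ => ?_
          rw [← sq_abs, pow_two]
          exact mul_le_mul_of_nonneg_right (hd k) (abs_nonneg _)
      _ ≤ fmax * (n * Δ / (2 * π) * ∫ ν in (-(π / Δ))..(π / Δ), |f ν γ - f ν γ₀|) := by
          rw [← Finset.mul_sum]
          gcongr
          exact sum_abs_expectedPeriodogram_le hΔ hn ((hr γ hγΘ).sub (hr γ₀ hγ₀)).integrable
      _ ≤ fmax * (n * Δ / (2 * π) * (η / (fmax * (Δ / (2 * π))))) := by gcongr
      _ = η * n := by field_simp

end Family

/-! ### Separation of parameters -/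

section Separation

variable {E : Type*} {Δ : ℝ} {f : ℝ → E → ℝ}
  {Θ : Set E} {θ : E} {r : E → ℤ → ℝ} {fmin fmax : ℝ}

theorem exists_autocovariance_ne (hΔ : 0 < Δ) (hfmin : 0 < fmin)
    (hbound : ∀ γ ∈ Θ, ∀ ω ∈ Set.Icc (-(π / Δ)) (π / Δ), fmin ≤ f ω γ ∧ f ω γ ≤ fmax)
    (hr : ∀ γ ∈ Θ, IsAutocovariance Δ (fun ω => f ω γ) (r γ)) {γ γ' : E} (hγ : γ ∈ Θ)
    (hγ' : γ' ∈ Θ)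
    (hident : volume {ω | ω ∈ Set.Icc (-(π / Δ)) (π / Δ) ∧ f ω γ ≠ f ω γ'} ≠ 0) :
    ∃ m : ℕ, r γ m - r γ' m ≠ 0 := by
  by_contra! hcon
  have heq : r γ' = r γ := by
    funext τ
    obtain ⟨m, rfl | rfl⟩ := τ.eq_nat_or_neg
    · exact (sub_eq_zero.1 (hcon m)).symm
    · rw [(hr γ hγ).neg, (hr γ' hγ').neg]; exact (sub_eq_zero.1 (hcon m)).symm
  have h' := hr γ' hγ'
  rw [heq] at h'
  have hae := (hr γ hγ).ae_eq_of_eq h' hΔ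
    (fun ν hν => abs_sub_le_of_bound hfmin hbound hγ hγ' hν)
  rw [Measure.restrict_congr_set Ioc_ae_eq_Icc, ae_restrict_iff' measurableSet_Icc] at hae
  refine hident (measure_mono_null (fun ω hω => ?_) hae)
  simp only [Set.mem_ofPred_eq] at hω
  simp only [Set.mem_compl_iff, Set.mem_ofPred_eq, Classical.not_imp]
  exact hω

variable [NormedAddCommGroup E] [NormedSpace ℝ E]

/-- The covariances are Lipschitz at `θ`, uniformly in the lag: near `θ` because the expected
periodograms are, uniformly in `n`, and away from `θ` because the densities are bounded. -/
theorem exists_abs_autocovariance_sub_le (hΔ : 0 < Δ) (hfmin : 0 < fmin) (hθ : θ ∈ interior Θ)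
    (hbound : ∀ γ ∈ Θ, ∀ ω ∈ Set.Icc (-(π / Δ)) (π / Δ), fmin ≤ f ω γ ∧ f ω γ ≤ fmax)
    (hr : ∀ γ ∈ Θ, IsAutocovariance Δ (fun ω => f ω γ) (r γ))
    (hdiff : ∀ n : ℕ, 0 < n → ∀ ω ∈ Set.Icc (-(π / Δ)) (π / Δ),
      DifferentiableOn ℝ (fun γ => expectedPeriodogram Δ n (fun ν => f ν γ) ω) (interior Θ))
    {C : ℝ} (hderiv : ∀ n : ℕ, 0 < n → ∀ ω ∈ Set.Icc (-(π / Δ)) (π / Δ), ∀ γ ∈ interior Θ,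
      ‖fderiv ℝ (fun γ' => expectedPeriodogram Δ n (fun ν => f ν γ') ω) γ‖ ≤ C) :
    ∃ K : ℝ, 0 ≤ K ∧ ∀ γ ∈ Θ, ∀ τ : ℤ, |r γ τ - r θ τ| ≤ K * ‖γ - θ‖ := by
  have hp : 0 < π / Δ := by positivity
  have hθΘ := interior_subset hθ
  obtain ⟨δ, hδ, hball⟩ := Metric.isOpen_iff.1 isOpen_interior θ hθ
  have hF : 0 < fmax := by
    have := hbound θ hθΘ 0 ⟨by linarith, hp.le⟩
    linarith
  have hC : 0 ≤ C := (norm_nonneg _).trans (hderiv 1 one_pos 0 ⟨by linarith, hp.le⟩ θ hθ)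
  refine ⟨C / Δ + fmax / Δ / δ, by positivity, fun γ hγ τ => ?_⟩
  have hac := (hr γ hγ).sub (hr θ hθΘ)
  by_cases hn : ‖γ - θ‖ < δ
  · have h1 : Δ * |r γ τ - r θ τ| ≤ C * ‖γ - θ‖ := by
      refine hac.mul_abs_le_of_forall hΔ (fun n hn0 k hk => ?_) τ
      have hω := fourierFreq_mem_Icc hΔ hn0 hk
      rw [← (hr γ hγ).expectedPeriodogram_sub (hr θ hθΘ) hn0, ← Real.norm_eq_abs]
      refine (convex_ball θ δ).norm_image_sub_le_of_norm_fderiv_le (𝕜 := ℝ)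
        (f := fun γ => expectedPeriodogram Δ n (fun ν => f ν γ) (fourierFreq Δ n k))
        (fun x hx => ?_) (fun x hx => hderiv n hn0 _ hω x (hball hx)) (Metric.mem_ball_self hδ)
        (by rwa [mem_ball_iff_norm])
      exact (hdiff n hn0 _ hω).differentiableAt (isOpen_interior.mem_nhds (hball hx))
    have h2 : |r γ τ - r θ τ| ≤ C / Δ * ‖γ - θ‖ := by
      rw [div_mul_eq_mul_div, le_div_iff₀ hΔ]; linarith
    have : 0 ≤ fmax / Δ / δ * ‖γ - θ‖ := by positivity
    rw [add_mul]; linarith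
  · rw [not_lt] at hn
    have h1 : |r γ τ - r θ τ| ≤ fmax / Δ := by
      refine (hac.abs_le hΔ τ).trans ?_
      calc (2 * π)⁻¹ * ∫ ν in (-(π / Δ))..(π / Δ), |f ν γ - f ν θ|
          ≤ (2 * π)⁻¹ * ∫ ν in (-(π / Δ))..(π / Δ), fmax := by
            gcongr
            exact intervalIntegral.integral_mono_on (by linarith) hac.integrable.abs (by simp)
              fun ν hν => abs_sub_le_of_bound hfmin hbound hγ hθΘ hν
        _ = fmax / Δ := by
            rw [intervalIntegral.integral_const, smul_eq_mul]; field_simp; ring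
    have h2 : fmax / Δ ≤ fmax / Δ / δ * ‖γ - θ‖ := by
      rw [div_mul_eq_mul_div, le_div_iff₀ hδ]
      gcongr
    have : 0 ≤ C / Δ * ‖γ - θ‖ := by positivity
    rw [add_mul]; linarith

/-- Near `θ`, non-degeneracy of the derivative of the expected periodogram in every direction makes
finitely many covariances separate the parameters linearly. -/
theorem eventually_exists_le_abs_autocovariance_sub [FiniteDimensional ℝ E] (hΔ : 0 < Δ)
    (hθ : θ ∈ interior Θ)
    (hr : ∀ γ ∈ Θ, IsAutocovariance Δ (fun ω => f ω γ) (r γ))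
    (hdiff : ∀ n : ℕ, 0 < n → ∀ ω ∈ Set.Icc (-(π / Δ)) (π / Δ),
      DifferentiableOn ℝ (fun γ => expectedPeriodogram Δ n (fun ν => f ν γ) ω) (interior Θ))
    (hne : ∀ u : E, u ≠ 0 → ∃ n : ℕ, 0 < n ∧ ∃ ω ∈ Set.Icc (-(π / Δ)) (π / Δ),
      fderiv ℝ (fun γ => expectedPeriodogram Δ n (fun ν => f ν γ) ω) θ u ≠ 0) :
    ∃ T : ℕ, ∃ c : ℝ, 0 < c ∧ ∀ᶠ γ in nhds θ, γ ∈ Θ →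
      ∃ m : ℕ, m ≤ T ∧ c * ‖γ - θ‖ ≤ |r γ m - r θ m| := by
  classical
  have hθΘ := interior_subset hθ
  let J := {q : ℕ × ℝ // 0 < q.1 ∧ q.2 ∈ Set.Icc (-(π / Δ)) (π / Δ)}
  let a : J → E → ℝ := fun q γ => expectedPeriodogram Δ q.1.1 (fun ν => f ν γ) q.1.2
  obtain ⟨T₀, c₀, hc₀, hT₀⟩ := exists_finset_forall_le_abs (isCompact_sphere (0 : E) 1)
    (φ := fun (q : J) u => fderiv ℝ (a q) θ u)
    (fun q => (fderiv ℝ (a q) θ).continuous.continuousOn) (fun u hu => by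
      have hu0 : u ≠ 0 := by
        rintro rfl
        simp at hu
      obtain ⟨n, hn, ω, hω, h⟩ := hne u hu0
      exact ⟨⟨(n, ω), hn, hω⟩, h⟩)
  obtain ⟨T, hT⟩ : ∃ T : ℕ, ∀ q ∈ T₀, q.1.1 ≤ T :=
    ⟨T₀.sup fun q => q.1.1, fun q hq => Finset.le_sup (f := fun q : J => q.1.1) hq⟩
  have hev : ∀ᶠ γ in nhds θ, ∀ q ∈ T₀,
      ‖a q γ - a q θ - fderiv ℝ (a q) θ (γ - θ)‖ ≤ c₀ / 2 * ‖γ - θ‖ := by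
    rw [eventually_all_finset]
    intro q _
    have hd : HasFDerivAt (a q) (fderiv ℝ (a q) θ) θ :=
      ((hdiff q.1.1 q.2.1 q.1.2 q.2.2).differentiableAt
        (isOpen_interior.mem_nhds hθ)).hasFDerivAt
    exact hd.isLittleO.def (half_pos hc₀)
  refine ⟨T, c₀ / (2 * (Δ * (T + 1))), by positivity, ?_⟩
  filter_upwards [hev] with γ hγ hγΘ
  by_cases h0 : γ = θ
  · subst h0
    exact ⟨0, Nat.zero_le _, by simp⟩
  have hx : 0 < ‖γ - θ‖ := norm_pos_iff.2 (sub_ne_zero.2 h0)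
  obtain ⟨q, hq, hle⟩ := hT₀ (‖γ - θ‖⁻¹ • (γ - θ)) (by
    rw [mem_sphere_zero_iff_norm, norm_smul, norm_inv, norm_norm, inv_mul_cancel₀ hx.ne'])
  have h1 : c₀ * ‖γ - θ‖ ≤ |fderiv ℝ (a q) θ (γ - θ)| := by
    rw [map_smul, smul_eq_mul, abs_mul, abs_of_pos (inv_pos.2 hx), ← div_eq_inv_mul,
      le_div_iff₀ hx] at hle
    exact hle
  have h2 := hγ q hq
  rw [Real.norm_eq_abs] at h2
  have h3 : c₀ / 2 * ‖γ - θ‖ ≤ |a q γ - a q θ| := by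
    have h4 := abs_sub_abs_le_abs_sub (fderiv ℝ (a q) θ (γ - θ)) (a q γ - a q θ)
    rw [abs_sub_comm (fderiv ℝ (a q) θ (γ - θ)) (a q γ - a q θ)] at h4
    linarith
  obtain ⟨m, hm, hle'⟩ := ((hr γ hγΘ).sub (hr θ hθΘ)).exists_abs_expectedPeriodogram_le hΔ q.2.1
    q.1.2
  rw [← (hr γ hγΘ).expectedPeriodogram_sub (hr θ hθΘ) q.2.1] at hle'
  refine ⟨m, hm.le.trans (hT q hq), ?_⟩
  have h5 : Δ * (q.1.1 : ℝ) * |r γ m - r θ m| ≤ Δ * (T + 1) * |r γ m - r θ m| := by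
    have : (q.1.1 : ℝ) ≤ T := by exact_mod_cast hT q hq
    gcongr
    linarith
  have h6 : c₀ / 2 * ‖γ - θ‖ ≤ Δ * (T + 1) * |r γ m - r θ m| := (h3.trans hle').trans h5
  rw [div_mul_eq_mul_div, div_le_iff₀ (by positivity)]
  linarith

/-- The expected periodograms at the Fourier frequencies separate the parameters: their mean-square
distance dominates the squared distance of the parameters. -/
theorem exists_sum_sq_sub_ge [FiniteDimensional ℝ E] (hΔ : 0 < Δ) (hfmin : 0 < fmin)
    (hΘ : IsCompact Θ) (hθ : θ ∈ interior Θ)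
    (hbound : ∀ γ ∈ Θ, ∀ ω ∈ Set.Icc (-(π / Δ)) (π / Δ), fmin ≤ f ω γ ∧ f ω γ ≤ fmax)
    (hr : ∀ γ ∈ Θ, IsAutocovariance Δ (fun ω => f ω γ) (r γ))
    (hident : ∀ γ ∈ Θ, ∀ γ' ∈ Θ, γ ≠ γ' →
      volume {ω | ω ∈ Set.Icc (-(π / Δ)) (π / Δ) ∧ f ω γ ≠ f ω γ'} ≠ 0)
    (hcont : ∀ ω ∈ Set.Icc (-(π / Δ)) (π / Δ), ContinuousOn (fun γ => f ω γ) Θ)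
    (hdiff : ∀ n : ℕ, 0 < n → ∀ ω ∈ Set.Icc (-(π / Δ)) (π / Δ),
      DifferentiableOn ℝ (fun γ => expectedPeriodogram Δ n (fun ν => f ν γ) ω) (interior Θ))
    {C : ℝ} (hderiv : ∀ n : ℕ, 0 < n → ∀ ω ∈ Set.Icc (-(π / Δ)) (π / Δ), ∀ γ ∈ interior Θ,
      ‖fderiv ℝ (fun γ' => expectedPeriodogram Δ n (fun ν => f ν γ') ω) γ‖ ≤ C)
    (hne : ∀ u : E, u ≠ 0 → ∃ n : ℕ, 0 < n ∧ ∃ ω ∈ Set.Icc (-(π / Δ)) (π / Δ),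
      fderiv ℝ (fun γ => expectedPeriodogram Δ n (fun ν => f ν γ) ω) θ u ≠ 0) :
    ∃ c : ℝ, 0 < c ∧ ∀ᶠ n : ℕ in atTop, ∀ γ ∈ Θ, c * n * ‖γ - θ‖ ^ 2 ≤
      ∑ k ∈ fourierIndices n,
        (expectedPeriodogram Δ n (fun ν => f ν γ) (fourierFreq Δ n k) -
          expectedPeriodogram Δ n (fun ν => f ν θ) (fourierFreq Δ n k)) ^ 2 := by
  have hθΘ := interior_subset hθ
  obtain ⟨K, hK, hlip⟩ := exists_abs_autocovariance_sub_le hΔ hfmin hθ hbound hr hdiff hderiv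
  obtain ⟨T₁, c₁, hc₁, hev⟩ := eventually_exists_le_abs_autocovariance_sub hΔ hθ hr hdiff hne
  obtain ⟨δ, hδ, hball⟩ := Metric.eventually_nhds_iff.1 hev
  obtain ⟨T₂, c₂, hc₂, hfar⟩ := exists_finset_forall_le_abs (S := Θ \ Metric.ball θ δ)
    (hΘ.diff Metric.isOpen_ball) (φ := fun (m : ℕ) γ => r γ m - r θ m)
    (fun m => ((continuousOn_autocovariance hΔ hfmin hbound hr hcont m).sub
      continuousOn_const).mono Set.sdiff_subset)
    (fun γ hγ => exists_autocovariance_ne hΔ hfmin hbound hr hγ.1 hθΘ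
      (hident γ hγ.1 θ hθΘ (by
        rintro rfl
        exact hγ.2 (Metric.mem_ball_self hδ))))
  obtain ⟨D, hD, hdiam⟩ : ∃ D : ℝ, 0 < D ∧ ∀ γ ∈ Θ, ‖γ - θ‖ ≤ D := by
    obtain ⟨D, hD⟩ := hΘ.isBounded.subset_closedBall θ
    refine ⟨max D 1, by positivity, fun γ hγ => ?_⟩
    have := hD hγ
    rw [mem_closedBall_iff_norm] at this
    exact this.trans (le_max_left _ _)
  -- Near `θ` the derivatives separate, away from `θ` identifiability and compactness do.
  obtain ⟨T, c, hc, hsep⟩ : ∃ T : ℕ, ∃ c : ℝ, 0 < c ∧ ∀ γ ∈ Θ,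
      ∃ m : ℕ, m ≤ T ∧ c * ‖γ - θ‖ ≤ |r γ m - r θ m| := by
    refine ⟨max T₁ (T₂.sup id), min c₁ (c₂ / D), lt_min hc₁ (div_pos hc₂ hD), fun γ hγ => ?_⟩
    by_cases hn : dist γ θ < δ
    · obtain ⟨m, hm, hle⟩ := hball hn hγ
      exact ⟨m, hm.trans (le_max_left _ _), le_trans (by gcongr; exact min_le_left _ _) hle⟩
    · obtain ⟨m, hm, hle⟩ := hfar γ ⟨hγ, hn⟩
      refine ⟨m, (Finset.le_sup (f := id) hm).trans (le_max_right _ _), le_trans ?_ hle⟩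
      calc min c₁ (c₂ / D) * ‖γ - θ‖ ≤ c₂ / D * D := by
            gcongr
            · exact min_le_right _ _
            · exact hdiam γ hγ
        _ = c₂ := by field_simp
  obtain ⟨n₀, hn₀⟩ := exists_nat_ge (4 * K * T / c)
  refine ⟨(Δ * c / 2) ^ 2, by positivity, ?_⟩
  filter_upwards [eventually_gt_atTop (max T n₀)] with n hn γ hγ
  have hnT : T < n := (le_max_left _ _).trans_lt hn
  have hnn₀ : (n₀ : ℝ) ≤ n := by exact_mod_cast ((le_max_right _ _).trans_lt hn).le
  have hn0 : 0 < n := by omega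
  obtain ⟨m, hm, hle⟩ := hsep γ hγ
  have hac := (hr γ hγ).sub (hr θ hθΘ)
  have h1 := hac.mul_abs_le_sum_add hΔ (hlip γ hγ) (hm.trans_lt hnT)
  set S := ∑ k ∈ fourierIndices n,
    |expectedPeriodogram Δ n (fun ν => f ν γ - f ν θ) (fourierFreq Δ n k)| with hS
  simp only [(hr γ hγ).expectedPeriodogram_sub (hr θ hθΘ) hn0]
  have h2 : S ^ 2 ≤ n * ∑ k ∈ fourierIndices n,
      (expectedPeriodogram Δ n (fun ν => f ν γ - f ν θ) (fourierFreq Δ n k)) ^ 2 := by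
    have := sq_sum_le_card_mul_sum_sq (s := fourierIndices n)
      (f := fun k => |expectedPeriodogram Δ n (fun ν => f ν γ - f ν θ) (fourierFreq Δ n k)|)
    simpa only [card_fourierIndices, sq_abs] using this
  have hx : 0 ≤ ‖γ - θ‖ := norm_nonneg _
  have h3 : 2 * K * m ≤ n * c / 2 := by
    have h4 : 4 * K * T ≤ n * c := by
      rw [div_le_iff₀ hc] at hn₀
      nlinarith
    have h5 : (m : ℝ) ≤ T := by exact_mod_cast hm
    nlinarith
  have h6 : n * (Δ * c / 2) * ‖γ - θ‖ ≤ S := by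
    have e1 : n * (Δ * (c * ‖γ - θ‖)) ≤ n * (Δ * |r γ m - r θ m|) := by gcongr
    have e2 : 2 * (K * ‖γ - θ‖) * Δ * m ≤ n * c / 2 * (‖γ - θ‖ * Δ) := by
      calc 2 * (K * ‖γ - θ‖) * Δ * m = 2 * K * m * (‖γ - θ‖ * Δ) := by ring
        _ ≤ _ := by gcongr
    linarith
  have h7 : (n * (Δ * c / 2) * ‖γ - θ‖) ^ 2 ≤ S ^ 2 := by gcongr
  have hn' : (0 : ℝ) < n := by exact_mod_cast hn0
  refine le_of_mul_le_mul_left ?_ hn'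
  calc (n : ℝ) * ((Δ * c / 2) ^ 2 * n * ‖γ - θ‖ ^ 2) = (n * (Δ * c / 2) * ‖γ - θ‖) ^ 2 := by ring
    _ ≤ _ := h7.trans h2

end Separation

/-! ### Taylor expansion of the reciprocal and union bound -/

section Taylor

variable {E : Type*} [NormedAddCommGroup E] [NormedSpace ℝ E]

/-- A first-order expansion of the reciprocal of a `C²` function bounded away from zero: the
remainder is Lipschitz, with constant proportional to the distance from the base point. -/
theorem exists_inv_expansion {a : E → ℝ} {θ : E} {δ m C : ℝ} (hδ : 0 < δ) (hm : 0 < m)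
    (hlow : ∀ γ ∈ Metric.ball θ δ, m ≤ a γ)
    (hsmooth : ContDiffOn ℝ 2 a (Metric.ball θ δ))
    (h1 : ∀ γ ∈ Metric.ball θ δ, ‖fderiv ℝ a γ‖ ≤ C)
    (h2 : ∀ γ ∈ Metric.ball θ δ, ‖fderiv ℝ (fderiv ℝ a) γ‖ ≤ C) :
    ∃ L : E →L[ℝ] ℝ, ‖L‖ ≤ C / m ^ 2 + 2 * C ^ 2 / m ^ 3 ∧ ∀ ρ < δ, ∀ γ ∈ Metric.closedBall θ ρ,
      ∀ γ' ∈ Metric.closedBall θ ρ,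
        |((a γ)⁻¹ - (a θ)⁻¹ - L (γ - θ)) - ((a γ')⁻¹ - (a θ)⁻¹ - L (γ' - θ))| ≤
          (C / m ^ 2 + 2 * C ^ 2 / m ^ 3) * ρ * ‖γ - γ'‖ := by
  have hθ : θ ∈ Metric.ball θ δ := Metric.mem_ball_self hδ
  have hC : 0 ≤ C := (norm_nonneg _).trans (h1 θ hθ)
  have hpos : ∀ γ ∈ Metric.ball θ δ, 0 < a γ := fun γ hγ => hm.trans_le (hlow γ hγ)
  have hd : ∀ γ ∈ Metric.ball θ δ, DifferentiableAt ℝ a γ := fun γ hγ =>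
    (hsmooth.differentiableOn (by norm_num)).differentiableAt (Metric.isOpen_ball.mem_nhds hγ)
  have hd2 : ∀ γ ∈ Metric.ball θ δ, DifferentiableAt ℝ (fderiv ℝ a) γ := fun γ hγ =>
    ((hsmooth.fderiv_of_isOpen Metric.isOpen_ball (m := 1) (by norm_num)).differentiableOn
      (by norm_num)).differentiableAt (Metric.isOpen_ball.mem_nhds hγ)
  have hlip : ∀ γ ∈ Metric.ball θ δ, |a γ - a θ| ≤ C * ‖γ - θ‖ := fun γ hγ => by
    simpa only [Real.norm_eq_abs] using
      (convex_ball θ δ).norm_image_sub_le_of_norm_fderiv_le hd h1 hθ hγ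
  have hlip2 : ∀ γ ∈ Metric.ball θ δ, ‖fderiv ℝ a γ - fderiv ℝ a θ‖ ≤ C * ‖γ - θ‖ := fun γ hγ =>
    (convex_ball θ δ).norm_image_sub_le_of_norm_fderiv_le hd2 h2 hθ hγ
  set G : E → E →L[ℝ] ℝ := fun γ => -((a γ ^ 2)⁻¹ • fderiv ℝ a γ) with hG
  have hGd : ∀ γ ∈ Metric.ball θ δ, HasFDerivAt (fun γ => (a γ)⁻¹) (G γ) γ := by
    intro γ hγ
    refine ((hasDerivAt_inv (hpos γ hγ).ne').comp_hasFDerivAt γ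
      (hd γ hγ).hasFDerivAt).congr_fderiv ?_
    simp [hG]
  have hinv : ∀ γ ∈ Metric.ball θ δ, (a γ ^ 2)⁻¹ ≤ (m ^ 2)⁻¹ := fun γ hγ => by
    have := hlow γ hγ
    gcongr
  have hGlip : ∀ γ ∈ Metric.ball θ δ,
      ‖G γ - G θ‖ ≤ (C / m ^ 2 + 2 * C ^ 2 / m ^ 3) * ‖γ - θ‖ := by
    intro γ hγ
    have e : G γ - G θ = -((a θ ^ 2)⁻¹ • (fderiv ℝ a γ - fderiv ℝ a θ)) +
        -(((a γ ^ 2)⁻¹ - (a θ ^ 2)⁻¹) • fderiv ℝ a γ) := by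
      simp only [hG]; module
    have hpθ := hpos θ hθ
    have hpγ := hpos γ hγ
    have e2 : |(a γ ^ 2)⁻¹ - (a θ ^ 2)⁻¹| ≤ 2 * C / m ^ 3 * ‖γ - θ‖ := by
      have : (a γ ^ 2)⁻¹ - (a θ ^ 2)⁻¹ =
          (a θ - a γ) * ((a θ)⁻¹ * (a γ ^ 2)⁻¹ + (a γ)⁻¹ * (a θ ^ 2)⁻¹) := by
        field_simp
        ring
      rw [this, abs_mul, abs_sub_comm, abs_of_pos (by positivity :
        0 < (a θ)⁻¹ * (a γ ^ 2)⁻¹ + (a γ)⁻¹ * (a θ ^ 2)⁻¹)]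
      have i1 : (a θ)⁻¹ ≤ m⁻¹ := by have := hlow θ hθ; gcongr
      have i2 : (a γ)⁻¹ ≤ m⁻¹ := by have := hlow γ hγ; gcongr
      calc _ ≤ (C * ‖γ - θ‖) * (m⁻¹ * (m ^ 2)⁻¹ + m⁻¹ * (m ^ 2)⁻¹) := by
            gcongr
            · exact hlip γ hγ
            · exact hlow γ hγ
            · exact hlow θ hθ
        _ = 2 * C / m ^ 3 * ‖γ - θ‖ := by field_simp; ring
    rw [e]
    refine (norm_add_le _ _).trans ?_
    rw [norm_neg, norm_neg, norm_smul, norm_smul, Real.norm_eq_abs, Real.norm_eq_abs,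
      abs_of_pos (by positivity : 0 < (a θ ^ 2)⁻¹)]
    calc _ ≤ (m ^ 2)⁻¹ * (C * ‖γ - θ‖) + 2 * C / m ^ 3 * ‖γ - θ‖ * C := by
          gcongr
          · exact hlow θ hθ
          · exact hlip2 γ hγ
          · exact h1 γ hγ
      _ = _ := by ring
  refine ⟨G θ, ?_, fun ρ hρ γ hγ γ' hγ' => ?_⟩
  · simp only [hG, norm_neg, norm_smul, Real.norm_eq_abs]
    have hpθ := hpos θ hθ
    rw [abs_of_pos (by positivity : 0 < (a θ ^ 2)⁻¹)]
    have : 0 ≤ 2 * C ^ 2 / m ^ 3 := by positivity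
    calc _ ≤ (m ^ 2)⁻¹ * C := by
          gcongr
          · exact hlow θ hθ
          · exact h1 θ hθ
      _ = C / m ^ 2 := by ring
      _ ≤ _ := by linarith
  · have hsub : Metric.closedBall θ ρ ⊆ Metric.ball θ δ := Metric.closedBall_subset_ball hρ
    have := (convex_closedBall θ ρ).norm_image_sub_le_of_norm_hasFDerivWithin_le
      (f := fun γ => (a γ)⁻¹ - (a θ)⁻¹ - G θ (γ - θ)) (f' := fun γ => G γ - G θ)
      (C := (C / m ^ 2 + 2 * C ^ 2 / m ^ 3) * ρ) (fun x hx => ?_) (fun x hx => ?_) hγ' hγ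
    · simpa only [Real.norm_eq_abs] using this
    · exact (((hGd x (hsub hx)).sub_const _).sub
        ((G θ).hasFDerivAt.comp x ((hasFDerivAt_id x).sub_const θ))).hasFDerivWithinAt
    · refine (hGlip x (hsub hx)).trans ?_
      gcongr
      exact mem_closedBall_iff_norm.1 hx

end Taylor

section UnionBound

variable {Ω : Type*} [MeasurableSpace Ω] {P : Measure Ω} [IsFiniteMeasure P]

theorem measure_lt_le_of_integral_le {F : Ω → ℝ} (hF : Integrable F P) (h0 : ∀ w, 0 ≤ F w)
    {c b q : ℝ} (hb : 0 < b) (hc : ∫ w, F w ∂P ≤ c) (hq : c ≤ q * b) :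
    P {w | b < F w} ≤ ENNReal.ofReal q := by
  have h1 := mul_meas_ge_le_integral_of_nonneg (.of_forall h0) hF b
  have h2 : P.real {w | b ≤ F w} ≤ q := by
    have : b * P.real {w | b ≤ F w} ≤ b * q := by linarith
    exact le_of_mul_le_mul_left this hb
  calc P {w | b < F w} ≤ P {w | b ≤ F w} := measure_mono (Set.ofPred_subset_ofPred.2 fun w hw => le_of_lt hw)
    _ = ENNReal.ofReal (P.real {w | b ≤ F w}) := (ofReal_measureReal).symm
    _ ≤ ENNReal.ofReal q := ENNReal.ofReal_le_ofReal h2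

/-- Chebyshev's inequality and a union bound for finitely many weighted sums whose second moments
grow like the squared weights times `n`. -/
theorem measure_exists_lt_abs_sum_le {ι : Type*} {n : ℕ} {S : Finset ℤ} {N : ℤ → Ω → ℝ} {K : ℝ}
    (hmem : ∀ k, MemLp (N k) 2 P)
    (hvar : ∀ (b : ℤ → ℝ) (B : ℝ), (∀ k ∈ S, |b k| ≤ B) →
      ∫ w, (∑ k ∈ S, b k * N k w) ^ 2 ∂P ≤ K * B ^ 2 * n)
    (I : Finset ι) (b : ι → ℤ → ℝ) (B t : ι → ℝ) {q : ℝ} (hB : ∀ i ∈ I, ∀ k ∈ S, |b i k| ≤ B i)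
    (ht : ∀ i ∈ I, 0 < t i) (hq : ∀ i ∈ I, K * B i ^ 2 * n ≤ q * t i ^ 2) :
    P {w | ∃ i ∈ I, t i < |∑ k ∈ S, b i k * N k w|} ≤ ENNReal.ofReal (I.card * q) := by
  have hone : ∀ i ∈ I, P {w | t i < |∑ k ∈ S, b i k * N k w|} ≤ ENNReal.ofReal q := by
    intro i hi
    have hm : MemLp (fun w => ∑ k ∈ S, b i k * N k w) 2 P :=
      memLp_finsetSum _ fun k _ => (hmem k).const_mul _
    refine le_trans (measure_mono fun w hw => ?_)
      (measure_lt_le_of_integral_le (b := t i ^ 2) hm.integrable_sq (fun w => sq_nonneg _)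
        (pow_pos (ht i hi) 2) (hvar (b i) (B i) (hB i hi)) (hq i hi))
    simp only [Set.mem_ofPred_eq] at hw ⊢
    rw [← sq_abs (∑ k ∈ S, b i k * N k w)]
    exact pow_lt_pow_left₀ hw (ht i hi).le two_ne_zero
  have hU : {w | ∃ i ∈ I, t i < |∑ k ∈ S, b i k * N k w|} =
      ⋃ i ∈ I, {w | t i < |∑ k ∈ S, b i k * N k w|} := by
    ext w; simp
  rw [hU]
  refine (measure_biUnion_finset_le _ _).trans ((Finset.sum_le_sum hone).trans ?_)
  rw [Finset.sum_const, nsmul_eq_mul, ENNReal.ofReal_mul (Nat.cast_nonneg _),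
    ENNReal.ofReal_natCast]

end UnionBound

/-- The Cauchy-Schwarz inequality for sums of mean-square size `O(n)`. -/
theorem abs_sum_mul_le {S : Finset ℤ} {n : ℕ} {N d : ℤ → ℝ} {Q η : ℝ} (hQ : 0 ≤ Q) (hη : 0 ≤ η)
    (hN : ∑ k ∈ S, N k ^ 2 ≤ Q ^ 2 * n) (hd : ∑ k ∈ S, d k ^ 2 ≤ η ^ 2 * n) :
    |∑ k ∈ S, d k * N k| ≤ Q * η * n := by
  have h := Finset.sum_mul_sq_le_sq_mul_sq S d N
  have h0 : 0 ≤ ∑ k ∈ S, N k ^ 2 := Finset.sum_nonneg fun k _ => sq_nonneg _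
  have h1 : (∑ k ∈ S, d k * N k) ^ 2 ≤ (Q * η * n) ^ 2 := by
    calc _ ≤ (η ^ 2 * n) * (Q ^ 2 * n) := h.trans (by gcongr)
      _ = _ := by ring
  exact abs_le_of_sq_le_sq h1 (by positivity)

theorem abs_apply_le_norm_mul_sum {p : ℕ} (ℓ : EuclideanSpace ℝ (Fin p) →L[ℝ] ℝ)
    (z : EuclideanSpace ℝ (Fin p)) :
    |ℓ z| ≤ ‖z‖ * ∑ i, |ℓ (EuclideanSpace.single i 1)| := by
  have hz : z = ∑ i, z i • EuclideanSpace.single i (1 : ℝ) := by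
    have := (EuclideanSpace.basisFun (Fin p) ℝ).sum_repr z
    simpa using this.symm
  conv_lhs => rw [hz]
  rw [map_sum, Finset.mul_sum]
  refine (Finset.abs_sum_le_sum_abs _ _).trans (Finset.sum_le_sum fun i _ => ?_)
  rw [map_smul, smul_eq_mul, abs_mul]
  gcongr
  exact PiLp.norm_apply_le z i

/-! ### Rate of convergence from second moments -/

section MEstimation

variable {p : ℕ}

/-- The deterministic part of the rate of convergence. Writing `d k = g k γ - g k θ`, the hypothesis
`hbasic` bounds the squared error by the correlation of `d` with the noise `N`. The remaining
hypotheses control that correlation: on a finite set `Γ` of parameters that approximates all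
others (this excludes errors above `δ`), for the linear part of `d`, and for its Taylor remainder,
rescaled to the dyadic balls of radius `δ / 2 ^ j` and evaluated on a finite net `V` of the unit
ball. -/
theorem norm_sub_le_of_noise_le {n : ℕ} (hn : 0 < n) {S : Finset ℤ} (hS : S.card = n) {N : ℤ → ℝ}
    {g : ℤ → EuclideanSpace ℝ (Fin p) → ℝ} {L : ℤ → EuclideanSpace ℝ (Fin p) →L[ℝ] ℝ}
    {θ γ : EuclideanSpace ℝ (Fin p)} {c δ A Q η η' B : ℝ} (hc : 0 < c) (hδ : 0 < δ) (hA : 0 ≤ A)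
    (hQ : 0 ≤ Q) (hη : 0 ≤ η) (hη' : 0 ≤ η')
    (hQη : Q * η' ≤ c * δ ^ 2 / 4) (hAη : 4 * η * (1 + A * Q) ≤ c / 2)
    {R : ℤ → EuclideanSpace ℝ (Fin p) → ℝ} (hRdef : ∀ k z, R k z = g k z - g k θ - L k (z - θ))
    (hR : ∀ k ∈ S, ∀ ρ ≤ δ, ∀ z ∈ Metric.closedBall θ ρ, ∀ z' ∈ Metric.closedBall θ ρ,
      |R k z - R k z'| ≤ A * ρ * ‖z - z'‖)
    (hbasic : c * n * ‖γ - θ‖ ^ 2 ≤ |∑ k ∈ S, (g k γ - g k θ) * N k|)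
    (hN : ∑ k ∈ S, N k ^ 2 ≤ Q ^ 2 * n)
    {Γ V : Finset (EuclideanSpace ℝ (Fin p))}
    (hΓ : ∃ γ' ∈ Γ, ∑ k ∈ S, (g k γ - g k γ') ^ 2 ≤ η' ^ 2 * n)
    (hΓN : ∀ γ' ∈ Γ, |∑ k ∈ S, (g k γ' - g k θ) * N k| ≤ c * δ ^ 2 / 4 * n)
    (hV1 : ∀ v ∈ V, ‖v‖ ≤ 1)
    (hV : ∀ v : EuclideanSpace ℝ (Fin p), ‖v‖ ≤ 1 → ∃ v' ∈ V, ‖v - v'‖ ≤ η)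
    (hVN : ∀ j < Nat.sqrt n + 1, ∀ v ∈ V,
      |∑ k ∈ S, R k (θ + (δ / 2 ^ j) • v) * N k| ≤ η * (δ / 2 ^ j) ^ 2 * n)
    (hLN : ∀ i : Fin p, |∑ k ∈ S, L k (EuclideanSpace.single i 1) * N k| ≤ B * √n) :
    ‖γ - θ‖ ≤ max δ (2 * p * B / c) / √n := by
  have hn' : (0 : ℝ) < n := by exact_mod_cast hn
  have hsn : 0 < √(n : ℝ) := Real.sqrt_pos.2 hn'
  have hss : √(n : ℝ) * √n = n := Real.mul_self_sqrt hn'.le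
  set x := ‖γ - θ‖ with hx
  have hx0 : 0 ≤ x := norm_nonneg _
  -- The finite set `Γ` and Cauchy-Schwarz make the noise too small for errors above `δ`, which
  -- are therefore impossible.
  have hxδ : x ≤ δ := by
    by_contra! hlt
    obtain ⟨γ', hγ', hle⟩ := hΓ
    have h1 := abs_sum_mul_le hQ hη' hN hle
    have h2 := hΓN γ' hγ'
    have h3 : ∑ k ∈ S, (g k γ - g k θ) * N k =
        ∑ k ∈ S, (g k γ - g k γ') * N k + ∑ k ∈ S, (g k γ' - g k θ) * N k := by
      rw [← Finset.sum_add_distrib]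
      exact Finset.sum_congr rfl fun k _ => by ring
    rw [h3] at hbasic
    have h4 := hbasic.trans (abs_add_le _ _)
    have h5 : c * n * δ ^ 2 ≤ c * n * x ^ 2 := by gcongr
    have h6 : Q * η' * n ≤ c * δ ^ 2 / 4 * n := by gcongr
    have h7 : 0 < c * δ ^ 2 * n := by positivity
    linarith
  by_cases hsmall : x * √n ≤ δ
  · rw [le_div_iff₀ hsn]
    exact hsmall.trans (le_max_left _ _)
  rw [not_le] at hsmall
  have hxpos : 0 < x := by
    by_contra! h
    have : x = 0 := le_antisymm h hx0
    rw [this] at hsmall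
    linarith
  -- The dyadic radius comparable to the error; its index is at most `√n` since the error exceeds
  -- `δ / √n` and `j < 2 ^ j`.
  obtain ⟨j, hj1, hj2⟩ := exists_nat_pow_near_of_lt_one (div_pos hxpos hδ)
    ((div_le_one hδ).2 hxδ) (show (0 : ℝ) < 1 / 2 by norm_num) (by norm_num)
  set ρ := δ / 2 ^ j with hρ
  have hρ0 : 0 < ρ := by positivity
  have hρδ : ρ ≤ δ := div_le_self hδ.le (one_le_pow₀ (by norm_num))
  have hxρ : x ≤ ρ := by
    rw [div_le_iff₀ hδ, one_div, inv_pow, inv_mul_eq_div] at hj2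
    exact hj2
  have hρx : ρ ≤ 2 * x := by
    rw [lt_div_iff₀ hδ, pow_succ, one_div, inv_pow] at hj1
    rw [hρ, div_eq_mul_inv]
    linarith
  have hjn : j < Nat.sqrt n + 1 := by
    rw [Nat.lt_succ_iff, Nat.le_sqrt]
    have h1 : (2 : ℝ) ^ j < √n := by
      have : δ < δ / 2 ^ j * √n := hsmall.trans_le (by gcongr)
      rw [div_mul_eq_mul_div, lt_div_iff₀ (by positivity)] at this
      exact lt_of_mul_lt_mul_left this hδ.le
    have h2 : (j : ℝ) < 2 ^ j := by exact_mod_cast Nat.lt_two_pow_self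
    have h3 : (j : ℝ) * j ≤ √n * √n := by gcongr <;> linarith
    rw [hss] at h3
    exact_mod_cast h3
  -- Replacing the rescaled error by a point of the net costs `A ρ² η` per frequency.
  set v := ρ⁻¹ • (γ - θ) with hv
  have hγv : γ = θ + ρ • v := by
    rw [hv, smul_inv_smul₀ hρ0.ne']; abel
  obtain ⟨v', hv', hvv'⟩ := hV v (by
    rw [hv, norm_smul, norm_inv, Real.norm_eq_abs, abs_of_pos hρ0, inv_mul_le_iff₀ hρ0, mul_one]
    exact hxρ)
  have hNabs : ∑ k ∈ S, |N k| ≤ Q * n := by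
    have h1 := sq_sum_le_card_mul_sum_sq (s := S) (f := fun k => |N k|)
    simp only [sq_abs, hS] at h1
    have h2 : (∑ k ∈ S, |N k|) ^ 2 ≤ (Q * n) ^ 2 := by
      calc _ ≤ n * (Q ^ 2 * n) := h1.trans (by gcongr)
        _ = _ := by ring
    exact (le_abs_self _).trans (abs_le_of_sq_le_sq h2 (by positivity))
  have hrem : |∑ k ∈ S, R k γ * N k| ≤ 4 * η * (1 + A * Q) * n * x ^ 2 := by
    have h1 : |∑ k ∈ S, (R k γ - R k (θ + ρ • v')) * N k| ≤ A * ρ * (ρ * η) * (Q * n) := by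
      calc _ ≤ ∑ k ∈ S, |(R k γ - R k (θ + ρ • v')) * N k| := Finset.abs_sum_le_sum_abs _ _
        _ ≤ ∑ k ∈ S, A * ρ * (ρ * η) * |N k| := by
            refine Finset.sum_le_sum fun k hk => ?_
            rw [abs_mul]
            refine mul_le_mul_of_nonneg_right ((hR k hk ρ hρδ γ ?_ _ ?_).trans ?_) (abs_nonneg _)
            · rwa [mem_closedBall_iff_norm]
            · rw [mem_closedBall_iff_norm, add_sub_cancel_left, norm_smul, Real.norm_eq_abs,
                abs_of_pos hρ0]
              exact mul_le_of_le_one_right hρ0.le (hV1 v' hv')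
            · gcongr
              rw [hγv, add_sub_add_left_eq_sub, ← smul_sub, norm_smul, Real.norm_eq_abs,
                abs_of_pos hρ0]
              gcongr
        _ ≤ A * ρ * (ρ * η) * (Q * n) := by
            rw [← Finset.mul_sum]
            gcongr
    have h2 := hVN j hjn v' hv'
    have h3 : ∑ k ∈ S, R k γ * N k = ∑ k ∈ S, (R k γ - R k (θ + ρ • v')) * N k +
        ∑ k ∈ S, R k (θ + ρ • v') * N k := by
      rw [← Finset.sum_add_distrib]
      exact Finset.sum_congr rfl fun k _ => by ring
    rw [h3]
    calc _ ≤ A * ρ * (ρ * η) * (Q * n) + η * ρ ^ 2 * n :=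
          (abs_add_le _ _).trans (add_le_add h1 h2)
      _ = η * (1 + A * Q) * n * ρ ^ 2 := by ring
      _ ≤ η * (1 + A * Q) * n * (2 * x) ^ 2 := by gcongr
      _ = _ := by ring
  have hlin : |∑ k ∈ S, L k (γ - θ) * N k| ≤ x * (p * (B * √n)) := by
    have h1 := abs_apply_le_norm_mul_sum (∑ k ∈ S, N k • L k) (γ - θ)
    have e : ∀ z, (∑ k ∈ S, N k • L k) z = ∑ k ∈ S, L k z * N k := fun z => by
      simp [sum_apply, smul_apply, mul_comm]
    simp only [e] at h1
    refine h1.trans ?_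
    gcongr
    calc _ ≤ ∑ _i : Fin p, B * √n := Finset.sum_le_sum fun i _ => hLN i
      _ = p * (B * √n) := by simp
  have hsplit : ∑ k ∈ S, (g k γ - g k θ) * N k =
      ∑ k ∈ S, L k (γ - θ) * N k + ∑ k ∈ S, R k γ * N k := by
    rw [← Finset.sum_add_distrib]
    exact Finset.sum_congr rfl fun k _ => by rw [hRdef]; ring
  rw [hsplit] at hbasic
  have h1 := hbasic.trans (abs_add_le _ _)
  have h2 : 4 * η * (1 + A * Q) * n * x ^ 2 ≤ c / 2 * n * x ^ 2 := by gcongr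
  have h3 : x * (c / 2 * (√n * x) * √n) ≤ x * (p * B * √n) := by
    have : x * (c / 2 * (√n * x) * √n) = c / 2 * n * x ^ 2 := by
      linear_combination c / 2 * x ^ 2 * hss
    rw [this]
    linarith
  have h4 : c / 2 * (√n * x) ≤ p * B :=
    le_of_mul_le_mul_right (le_of_mul_le_mul_left h3 hxpos) hsn
  refine le_trans ?_ (div_le_div_of_nonneg_right (le_max_right _ _) hsn.le)
  rw [div_div, le_div_iff₀ (by positivity)]
  linarith

theorem tendsto_sqrt_add_one_div_atTop :
    Tendsto (fun n : ℕ => ((Nat.sqrt n + 1 : ℕ) : ℝ) / n) atTop (nhds 0) := by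
  have h1 : Tendsto (fun n : ℕ => 1 / √(n : ℝ) + 1 / (n : ℝ)) atTop (nhds (0 + 0)) := by
    refine Tendsto.add ?_ tendsto_one_div_atTop_nhds_zero_nat
    simp only [one_div]
    exact (Real.tendsto_sqrt_atTop.comp tendsto_natCast_atTop_atTop).inv_tendsto_atTop
  rw [add_zero] at h1
  refine squeeze_zero' (.of_forall fun n => by positivity) ?_ h1
  filter_upwards [eventually_gt_atTop 0] with n hn
  have hn' : (0 : ℝ) < n := by exact_mod_cast hn
  have hsn : 0 < √(n : ℝ) := Real.sqrt_pos.2 hn'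
  have hss : √(n : ℝ) * √n = n := Real.mul_self_sqrt hn'.le
  have h2 : (Nat.sqrt n : ℝ) ≤ √n := Real.nat_sqrt_le_real_sqrt
  push_cast
  rw [add_div]
  refine add_le_add ?_ le_rfl
  rw [div_le_div_iff₀ hn' hsn, one_mul]
  calc (Nat.sqrt n : ℝ) * √n ≤ √n * √n := by gcongr
    _ = n := hss

/-- The rate of convergence in probability. The noise `N` enters only through second moments: the
remainder is handled by a union bound over `O(√n)` dyadic scales, each with a fixed finite net and
failure probability `O(1 / n)`. -/
theorem isBigOInProb_of_noise {Ω : Type*} [MeasurableSpace Ω] {P : Measure Ω}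
    [IsProbabilityMeasure P] {S : ℕ → Finset ℤ} (hS : ∀ n, (S n).card = n)
    {N : ℕ → ℤ → Ω → ℝ} {K : ℝ}
    (hmem : ∀ n, 0 < n → ∀ k, MemLp (N n k) 2 P)
    (hvar : ∀ n, 0 < n → ∀ (b : ℤ → ℝ) (B : ℝ), (∀ k ∈ S n, |b k| ≤ B) →
      ∫ w, (∑ k ∈ S n, b k * N n k w) ^ 2 ∂P ≤ K * B ^ 2 * n)
    (hsq : ∀ n, 0 < n → ∑ k ∈ S n, ∫ w, N n k w ^ 2 ∂P ≤ K * n)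
    {g : ℕ → ℤ → EuclideanSpace ℝ (Fin p) → ℝ} {L : ℕ → ℤ → EuclideanSpace ℝ (Fin p) →L[ℝ] ℝ}
    {Θ : Set (EuclideanSpace ℝ (Fin p))} {θ : EuclideanSpace ℝ (Fin p)} (hθ : θ ∈ Θ)
    {c δ A G : ℝ} (hc : 0 < c) (hδ : 0 < δ) (hA : 0 ≤ A)
    (hg : ∀ n, 0 < n → ∀ k ∈ S n, ∀ γ ∈ Θ, |g n k γ| ≤ G)
    (hL : ∀ n, 0 < n → ∀ k ∈ S n, ‖L n k‖ ≤ A)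
    (hR : ∀ n, 0 < n → ∀ k ∈ S n, ∀ ρ ≤ δ, ∀ z ∈ Metric.closedBall θ ρ,
      ∀ z' ∈ Metric.closedBall θ ρ,
      |(g n k z - g n k θ - L n k (z - θ)) - (g n k z' - g n k θ - L n k (z' - θ))| ≤
        A * ρ * ‖z - z'‖)
    (hnet : ∀ η : ℝ, 0 < η → ∃ Γ : Finset (EuclideanSpace ℝ (Fin p)), (Γ : Set _) ⊆ Θ ∧
      ∀ γ ∈ Θ, ∃ γ' ∈ Γ, ∀ n, 0 < n → ∑ k ∈ S n, (g n k γ - g n k γ') ^ 2 ≤ η ^ 2 * n)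
    {θhat : ℕ → Ω → EuclideanSpace ℝ (Fin p)}
    (hbasic : ∀ᶠ n : ℕ in atTop, ∀ᵐ w ∂P, θhat n w ∈ Θ ∧
      c * n * ‖θhat n w - θ‖ ^ 2 ≤ |∑ k ∈ S n, (g n k (θhat n w) - g n k θ) * N n k w|) :
    IsBigOInProb P (fun n w => θhat n w - θ) (fun n => (n : ℝ) ^ (-(1 / 2) : ℝ)) := by
  classical
  intro ε hε
  have hK : 0 ≤ K := by
    have := hsq 1 one_pos
    have h0 : 0 ≤ ∑ k ∈ S 1, ∫ w, N 1 k w ^ 2 ∂P :=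
      Finset.sum_nonneg fun k _ => integral_nonneg fun w => sq_nonneg _
    push_cast at this
    linarith
  obtain ⟨Q, hQ, hKQ⟩ : ∃ Q : ℝ, 0 < Q ∧ K ≤ ε / 4 * Q ^ 2 := by
    refine ⟨√(4 * K / ε) + 1, by positivity, ?_⟩
    have h1 : √(4 * K / ε) ^ 2 = 4 * K / ε := Real.sq_sqrt (by positivity)
    have h2 : 4 * K / ε ≤ (√(4 * K / ε) + 1) ^ 2 := by
      nlinarith [Real.sqrt_nonneg (4 * K / ε)]
    calc K = ε / 4 * (4 * K / ε) := by field_simp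
      _ ≤ _ := by gcongr
  obtain ⟨B, hB, hKB⟩ : ∃ B : ℝ, 0 < B ∧ p * (K * A ^ 2) ≤ ε / 4 * B ^ 2 := by
    refine ⟨√(4 * (p * (K * A ^ 2)) / ε) + 1, by positivity, ?_⟩
    set D := p * (K * A ^ 2) with hD
    have h1 : √(4 * D / ε) ^ 2 = 4 * D / ε := Real.sq_sqrt (by positivity)
    have h2 : 4 * D / ε ≤ (√(4 * D / ε) + 1) ^ 2 := by
      nlinarith [Real.sqrt_nonneg (4 * D / ε)]
    calc D = ε / 4 * (4 * D / ε) := by field_simp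
      _ ≤ _ := by gcongr
  set η := c / (8 * (1 + A * Q)) with hηdef
  have hη : 0 < η := by positivity
  set η' := c * δ ^ 2 / (4 * Q) with hη'def
  have hη' : 0 < η' := by positivity
  obtain ⟨Γ, hΓΘ, hΓ⟩ := hnet η' hη'
  obtain ⟨V, hV1, hV⟩ : ∃ V : Finset (EuclideanSpace ℝ (Fin p)), (∀ v ∈ V, ‖v‖ ≤ 1) ∧
      ∀ v : EuclideanSpace ℝ (Fin p), ‖v‖ ≤ 1 → ∃ v' ∈ V, ‖v - v'‖ ≤ η := by
    obtain ⟨V, hV1, hVfin, hV⟩ :=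
      (isCompact_closedBall (0 : EuclideanSpace ℝ (Fin p)) 1).finite_cover_balls hη
    refine ⟨hVfin.toFinset, fun v hv => by simpa using hV1 (hVfin.mem_toFinset.1 hv),
      fun v hv => ?_⟩
    obtain ⟨v', hv', hvv'⟩ := Set.mem_iUnion₂.1 (hV (by simpa using hv))
    exact ⟨v', hVfin.mem_toFinset.2 hv', (mem_ball_iff_norm.1 hvv').le⟩
  set η₁ := c * δ ^ 2 / 4 with hη₁def
  have hη₁ : 0 < η₁ := by positivity
  -- The failure probabilities of the two vanishing events
  have hlim1 : ∀ᶠ n : ℕ in atTop, Γ.card * (K * (2 * G) ^ 2 / (η₁ ^ 2 * n)) < ε / 4 := by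
    have : Tendsto (fun n : ℕ => Γ.card * (K * (2 * G) ^ 2) / η₁ ^ 2 / (n : ℝ)) atTop (nhds 0) :=
      tendsto_const_div_atTop_nhds_zero_nat _
    filter_upwards [this.eventually_lt_const (by positivity : 0 < ε / 4)] with n hn
    rw [← mul_div_assoc, ← div_div]
    exact hn
  have hlim2 : ∀ᶠ n : ℕ in atTop,
      ((Finset.range (Nat.sqrt n + 1) ×ˢ V).card : ℝ) * (K * A ^ 2 / (η ^ 2 * n)) < ε / 4 := by
    have := tendsto_sqrt_add_one_div_atTop.const_mul (V.card * (K * A ^ 2) / η ^ 2)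
    rw [mul_zero] at this
    filter_upwards [this.eventually_lt_const (by positivity : 0 < ε / 4)] with n hn
    rw [Finset.card_product, Finset.card_range]
    refine lt_of_eq_of_lt ?_ hn
    push_cast
    simp only [div_eq_mul_inv, mul_inv]
    ring
  refine ⟨max δ (2 * p * B / c), ?_⟩
  filter_upwards [hbasic, hlim1, hlim2, eventually_gt_atTop 0] with n hbn hl1 hl2 hn
  have hn' : (0 : ℝ) < n := by exact_mod_cast hn
  have hsn : 0 < √(n : ℝ) := Real.sqrt_pos.2 hn'
  have hss : √(n : ℝ) ^ 2 = n := Real.sq_sqrt hn'.le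
  set R : ℤ → EuclideanSpace ℝ (Fin p) → ℝ := fun k z => g n k z - g n k θ - L n k (z - θ) with hRdef
  set E₁ : Set Ω := {w | Q ^ 2 * n < ∑ k ∈ S n, N n k w ^ 2} with hE₁
  set E₂ : Set Ω := {w | ∃ γ' ∈ Γ, η₁ * n < |∑ k ∈ S n, (g n k γ' - g n k θ) * N n k w|} with hE₂
  set E₃ : Set Ω := {w | ∃ q ∈ Finset.range (Nat.sqrt n + 1) ×ˢ V,
    η * (δ / 2 ^ q.1) ^ 2 * n < |∑ k ∈ S n, R k (θ + (δ / 2 ^ q.1) • q.2) * N n k w|} with hE₃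
  set E₄ : Set Ω := {w | ∃ i ∈ (Finset.univ : Finset (Fin p)),
    B * √n < |∑ k ∈ S n, L n k (EuclideanSpace.single i 1) * N n k w|} with hE₄
  have p1 : P E₁ ≤ ENNReal.ofReal (ε / 4) := by
    refine measure_lt_le_of_integral_le (c := K * n)
      (integrable_finsetSum _ fun k _ => (hmem n hn k).integrable_sq)
      (fun w => Finset.sum_nonneg fun k _ => sq_nonneg _) (by positivity) ?_ ?_
    · rw [integral_finsetSum _ fun k _ => (hmem n hn k).integrable_sq]
      exact hsq n hn
    · rw [← mul_assoc]; gcongr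
  have p2 : P E₂ ≤ ENNReal.ofReal (ε / 4) := by
    refine (measure_exists_lt_abs_sum_le (hmem n hn) (hvar n hn) Γ
      (fun γ' k => g n k γ' - g n k θ) (fun _ => 2 * G) (fun _ => η₁ * n)
      (q := K * (2 * G) ^ 2 / (η₁ ^ 2 * n)) (fun γ' hγ' k hk => ?_)
      (fun _ _ => by positivity) (fun _ _ => ?_)).trans (ENNReal.ofReal_le_ofReal hl1.le)
    · have h1 := hg n hn k hk γ' (hΓΘ hγ')
      have h2 := hg n hn k hk θ hθ
      exact (abs_sub _ _).trans (by linarith)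
    · rw [div_mul_eq_mul_div, le_div_iff₀ (by positivity)]
      exact le_of_eq (by ring)
  have p3 : P E₃ ≤ ENNReal.ofReal (ε / 4) := by
    refine (measure_exists_lt_abs_sum_le (hmem n hn) (hvar n hn)
      (Finset.range (Nat.sqrt n + 1) ×ˢ V)
      (fun q k => R k (θ + (δ / 2 ^ q.1) • q.2)) (fun q => A * (δ / 2 ^ q.1) ^ 2)
      (fun q => η * (δ / 2 ^ q.1) ^ 2 * n)
      (q := K * A ^ 2 / (η ^ 2 * n)) (fun q hq k hk => ?_)
      (fun _ _ => by positivity) (fun q _ => ?_)).trans (ENNReal.ofReal_le_ofReal hl2.le)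
    · have hv := hV1 q.2 (Finset.mem_product.1 hq).2
      have hρ : 0 < δ / 2 ^ q.1 := by positivity
      have hn1 : ‖(δ / 2 ^ q.1) • q.2‖ ≤ δ / 2 ^ q.1 := by
        rw [norm_smul, Real.norm_eq_abs, abs_of_pos hρ]
        exact mul_le_of_le_one_right hρ.le hv
      have h1 := hR n hn k hk (δ / 2 ^ q.1) (div_le_self hδ.le (one_le_pow₀ (by norm_num)))
        (θ + (δ / 2 ^ q.1) • q.2) (by rwa [mem_closedBall_iff_norm, add_sub_cancel_left])
        θ (Metric.mem_closedBall_self hρ.le)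
      rw [sub_self θ, map_zero, sub_self, sub_zero, sub_zero, add_sub_cancel_left] at h1
      calc |R k (θ + (δ / 2 ^ q.1) • q.2)|
          ≤ A * (δ / 2 ^ q.1) * ‖(δ / 2 ^ q.1) • q.2‖ := by
            simpa only [hRdef, add_sub_cancel_left] using h1
        _ ≤ A * (δ / 2 ^ q.1) * (δ / 2 ^ q.1) := by gcongr
        _ = A * (δ / 2 ^ q.1) ^ 2 := by ring
    · rw [div_mul_eq_mul_div, le_div_iff₀ (by positivity)]
      exact le_of_eq (by ring)
  have p4 : P E₄ ≤ ENNReal.ofReal (ε / 4) := by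
    refine (measure_exists_lt_abs_sum_le (hmem n hn) (hvar n hn) Finset.univ
      (fun i k => L n k (EuclideanSpace.single i 1)) (fun _ => A) (fun _ => B * √n)
      (q := K * A ^ 2 / B ^ 2) (fun i _ k hk => ?_)
      (fun _ _ => by positivity) (fun _ _ => ?_)).trans (ENNReal.ofReal_le_ofReal ?_)
    · have := (L n k).le_opNorm (EuclideanSpace.single i 1)
      rw [PiLp.norm_single, norm_one, mul_one] at this
      exact this.trans (hL n hn k hk)
    · rw [mul_pow, hss]
      refine le_of_eq ?_
      field_simp
    · rw [Finset.card_univ, Fintype.card_fin, ← mul_div_assoc, div_le_iff₀ (by positivity)]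
      exact hKB
  have hsub : {w | max δ (2 * p * B / c) * (n : ℝ) ^ (-(1 / 2) : ℝ) < ‖θhat n w - θ‖} ≤ᵐ[P]
      (E₁ ∪ (E₂ ∪ (E₃ ∪ E₄)) : Set Ω) := by
    filter_upwards [hbn] with w hw hlt
    by_contra hcon
    have hcon' : w ∉ E₁ ∪ (E₂ ∪ (E₃ ∪ E₄)) := hcon
    simp only [hE₁, hE₂, hE₃, hE₄, Set.mem_union, Set.mem_ofPred_eq, not_or, not_exists, not_and,
      not_lt] at hcon'
    obtain ⟨c1, c2, c3, c4⟩ := hcon'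
    obtain ⟨γ', hγ', hle⟩ := hΓ _ hw.1
    have hfin := norm_sub_le_of_noise_le (θ := θ) (γ := θhat n w) (N := fun k => N n k w)
      (g := g n) (L := L n) (Γ := Γ) (V := V) hn (hS n) hc hδ hA hQ.le hη.le hη'.le
      (by rw [hη'def]; refine le_of_eq ?_; field_simp)
      (by rw [hηdef]; refine le_of_eq ?_; field_simp; ring) (R := R) (fun _ _ => rfl) (hR n hn)
      hw.2 c1 ⟨γ', hγ', hle n hn⟩ c2 hV1 hV
      (fun j hj v hv => c3 (j, v) (Finset.mk_mem_product (Finset.mem_range.2 hj) hv))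
      (fun i => c4 i (Finset.mem_univ i))
    have hrp : (n : ℝ) ^ (-(1 / 2) : ℝ) = (√n)⁻¹ := by
      rw [Real.rpow_neg hn'.le, Real.sqrt_eq_rpow]
    have hlt' : max δ (2 * p * B / c) * (n : ℝ) ^ (-(1 / 2) : ℝ) < ‖θhat n w - θ‖ := hlt
    rw [hrp, ← div_eq_mul_inv] at hlt'
    linarith
  calc _ ≤ P (E₁ ∪ (E₂ ∪ (E₃ ∪ E₄))) := measure_mono_ae hsub
    _ ≤ P E₁ + (P E₂ + (P E₃ + P E₄)) :=
        (measure_union_le _ _).trans (add_le_add le_rfl ((measure_union_le _ _).trans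
          (add_le_add le_rfl (measure_union_le _ _))))
    _ ≤ ENNReal.ofReal (ε / 4) + (ENNReal.ofReal (ε / 4) +
          (ENNReal.ofReal (ε / 4) + ENNReal.ofReal (ε / 4))) := by gcongr
    _ = ENNReal.ofReal ε := by
        rw [← ENNReal.ofReal_add (by positivity) (by positivity),
          ← ENNReal.ofReal_add (by positivity) (by positivity),
          ← ENNReal.ofReal_add (by positivity) (by positivity)]
        ring_nf

end MEstimation

/-! ### Consistency rate of the de-biased Whittle estimator -/

/-- The basic inequality at a maximiser of the likelihood: the squared distance of the expected
periodograms is dominated by the correlation of their reciprocals with the noise `I - a`. -/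
theorem sum_sq_sub_le_of_sum_log_le {S : Finset ℤ} {a a' I : ℤ → ℝ} {F : ℝ}
    (ha : ∀ k ∈ S, 0 < a k ∧ a k ≤ F) (ha' : ∀ k ∈ S, 0 < a' k ∧ a' k ≤ F)
    (h : ∑ k ∈ S, (Real.log (a' k) + I k / a' k) ≤ ∑ k ∈ S, (Real.log (a k) + I k / a k)) :
    (4 * F ^ 2)⁻¹ * ∑ k ∈ S, (a' k - a k) ^ 2 ≤
      |∑ k ∈ S, ((a' k)⁻¹ - (a k)⁻¹) * (I k - a k)| := by
  have h1 : ∑ k ∈ S, (a' k - a k) ^ 2 / (4 * F ^ 2) ≤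
      ∑ k ∈ S, (Real.log (a' k) - Real.log (a k) + a k / a' k - 1) :=
    Finset.sum_le_sum fun k hk => sq_sub_div_le_log_div_add (ha' k hk).1 (ha k hk).1
      (ha' k hk).2 (ha k hk).2
  have h2 : ∑ k ∈ S, (Real.log (a' k) - Real.log (a k) + a k / a' k - 1) =
      ∑ k ∈ S, (Real.log (a' k) + I k / a' k) - ∑ k ∈ S, (Real.log (a k) + I k / a k) -
        ∑ k ∈ S, ((a' k)⁻¹ - (a k)⁻¹) * (I k - a k) := by
    rw [← Finset.sum_sub_distrib, ← Finset.sum_sub_distrib]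
    refine Finset.sum_congr rfl fun k hk => ?_
    have h3 := (ha k hk).1.ne'
    have h4 := (ha' k hk).1.ne'
    field_simp
    ring
  rw [← Finset.sum_div, h2] at h1
  rw [inv_mul_eq_div]
  refine le_trans ?_ (neg_le_abs _)
  linarith

theorem inv_sub_inv_sq_le {m x y : ℝ} (hm : 0 < m) (hx : m ≤ x) (hy : m ≤ y) :
    (x⁻¹ - y⁻¹) ^ 2 ≤ (m ^ 4)⁻¹ * (x - y) ^ 2 := by
  have hx0 := hm.trans_le hx
  have hy0 := hm.trans_le hy
  have e : (x⁻¹ - y⁻¹) ^ 2 = ((x * y) ^ 2)⁻¹ * (x - y) ^ 2 := by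
    field_simp
    ring
  rw [e]
  have : m * m ≤ x * y := by gcongr
  have h2 : m ^ 4 ≤ (x * y) ^ 2 := by
    calc m ^ 4 = (m * m) ^ 2 := by ring
      _ ≤ _ := by gcongr
  gcongr

/-- A number of frequencies of exact order `n` is positive for some `n`. -/
theorem exists_fderiv_ne_zero_of_isTheta {E : Type*} [NormedAddCommGroup E] [NormedSpace ℝ E]
    {Δ : ℝ} (hΔ : 0 < Δ) {f : ℝ → E → ℝ} {θ u : E}
    (h : (fun n : ℕ => (Set.ncard {k : ℤ | k ∈ fourierIndices n ∧
        fderiv ℝ (fun γ => expectedPeriodogram Δ n (fun ν => f ν γ)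
          (fourierFreq Δ n k)) θ u ≠ 0} : ℝ)) =Θ[atTop] (fun n : ℕ => (n : ℝ))) :
    ∃ n : ℕ, 0 < n ∧ ∃ ω ∈ Set.Icc (-(π / Δ)) (π / Δ),
      fderiv ℝ (fun γ => expectedPeriodogram Δ n (fun ν => f ν γ) ω) θ u ≠ 0 := by
  obtain ⟨C, hC⟩ := h.2.bound
  obtain ⟨n, hn, hn0⟩ := (hC.and (eventually_gt_atTop 0)).exists
  have hne : {k : ℤ | k ∈ fourierIndices n ∧
        fderiv ℝ (fun γ => expectedPeriodogram Δ n (fun ν => f ν γ)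
          (fourierFreq Δ n k)) θ u ≠ 0}.Nonempty := by
    by_contra hemp
    rw [Set.not_nonempty_iff_eq_empty] at hemp
    rw [hemp] at hn
    simp at hn
    omega
  obtain ⟨k, hk, hku⟩ := hne
  exact ⟨n, hn0, _, fourierFreq_mem_Icc hΔ hn0 hk, hku⟩

end DebiasedWhittle

theorem theorem1 {Ω : Type*} [MeasurableSpace Ω] (P : Measure Ω) [IsProbabilityMeasure P]
    (p : ℕ) (Δ : ℝ) (hΔ : 0 < Δ)
    -- the parametric family of processes `X(t; γ)`, and the spectral densities `f(ω; γ)` of the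
    -- sampled sequences
    (X : EuclideanSpace ℝ (Fin p) → ℝ → Ω → ℝ)
    (f : ℝ → EuclideanSpace ℝ (Fin p) → ℝ)
    (Θ : Set (EuclideanSpace ℝ (Fin p))) (θ : EuclideanSpace ℝ (Fin p))
    (hspec : ∀ γ ∈ Θ,
      DebiasedWhittle.HasSpectralDensity P (DebiasedWhittle.sampled (X γ) Δ) Δ (fun ω => f ω γ))
    -- the observed sequence is Gaussian
    (hgauss : IsGaussianProcess (DebiasedWhittle.sampled (X θ) Δ) P)
    -- 1. compact parameter set, true parameter in its interior
    (hΘ : IsCompact Θ) (hθ : θ ∈ interior Θ)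
    -- 2. bounded spectral densities
    (fmin fmax : ℝ) (hfmin : 0 < fmin)
    (hbound : ∀ γ ∈ Θ, ∀ ω ∈ Set.Icc (-(π / Δ)) (π / Δ), fmin ≤ f ω γ ∧ f ω γ ≤ fmax)
    -- 3. identifiability
    (hident : ∀ γ ∈ Θ, ∀ γ' ∈ Θ, γ ≠ γ' →
      volume {ω | ω ∈ Set.Icc (-(π / Δ)) (π / Δ) ∧ f ω γ ≠ f ω γ'} ≠ 0)
    -- 4. continuity in the parameter, Riemann integrability in the frequency
    (hcont : ∀ ω ∈ Set.Icc (-(π / Δ)) (π / Δ), ContinuousOn (fun γ => f ω γ) Θ)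
    (hriem : ∀ γ ∈ Θ, DebiasedWhittle.RiemannIntegrableOn (fun ω => f ω γ) (-(π / Δ)) (π / Δ))
    -- 5. the expected periodogram is `C²` in the parameter with uniformly bounded derivatives
    (hsmooth : ∀ n : ℕ, 0 < n → ∀ ω ∈ Set.Icc (-(π / Δ)) (π / Δ),
      ContDiffOn ℝ 2
        (fun γ => DebiasedWhittle.expectedPeriodogram Δ n (fun ν => f ν γ) ω) (interior Θ))
    (hderiv : ∃ C : ℝ, ∀ n : ℕ, 0 < n → ∀ ω ∈ Set.Icc (-(π / Δ)) (π / Δ), ∀ γ ∈ interior Θ,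
      ‖fderiv ℝ (fun γ' => DebiasedWhittle.expectedPeriodogram Δ n (fun ν => f ν γ') ω) γ‖ ≤ C ∧
      ‖fderiv ℝ (fderiv ℝ
        (fun γ' => DebiasedWhittle.expectedPeriodogram Δ n (fun ν => f ν γ') ω)) γ‖ ≤ C)
    -- and its first derivative at the true parameter, in every direction, is non-zero at a number
    -- of Fourier frequencies of exact order `n`
    (hnonzero : ∀ u : EuclideanSpace ℝ (Fin p), u ≠ 0 →
      (fun n : ℕ => (Set.ncard {k : ℤ | k ∈ DebiasedWhittle.fourierIndices n ∧
        fderiv ℝ (fun γ => DebiasedWhittle.expectedPeriodogram Δ n (fun ν => f ν γ)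
          (DebiasedWhittle.fourierFreq Δ n k)) θ u ≠ 0} : ℝ))
        =Θ[atTop] (fun n : ℕ => (n : ℝ)))
    -- the estimator: any maximiser over `Θ` of the de-biased Whittle likelihood of `X_1, …, X_n`
    (θhat : ℕ → Ω → EuclideanSpace ℝ (Fin p))
    (hmax : ∀ n : ℕ, 0 < n → ∀ᵐ w ∂P, θhat n w ∈ Θ ∧
      IsMaxOn (DebiasedWhittle.debiasedWhittle Δ f n
        (fun t => DebiasedWhittle.sampled (X θ) Δ t w)) Θ (θhat n w)) :
    DebiasedWhittle.IsBigOInProb P (fun n w => θhat n w - θ)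
      (fun n => (n : ℝ) ^ (-(1 / 2) : ℝ)) := by
  classical
  have hθΘ : θ ∈ Θ := interior_subset hθ
  have hp : 0 < π / Δ := by positivity
  have hF : 0 < fmax := by
    have := hbound θ hθΘ 0 ⟨by linarith, hp.le⟩
    linarith
  have hr : ∀ γ ∈ Θ, DebiasedWhittle.IsAutocovariance Δ (fun ω => f ω γ)
      (fun τ => ∫ w, DebiasedWhittle.sampled (X γ) Δ τ w * DebiasedWhittle.sampled (X γ) Δ 0 w ∂P) :=
    fun γ hγ => (hspec γ hγ).isAutocovariance
  have ha : ∀ n : ℕ, 0 < n → ∀ ω, ∀ γ ∈ Θ,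
      DebiasedWhittle.expectedPeriodogram Δ n (fun ν => f ν γ) ω ∈ Set.Icc fmin fmax :=
    fun n hn ω γ hγ => DebiasedWhittle.expectedPeriodogram_mem_Icc hΔ hn (hr γ hγ).integrable
      (hbound γ hγ) ω
  obtain ⟨C, hC⟩ := hderiv
  have hC0 : 0 ≤ C := (norm_nonneg _).trans (hC 1 one_pos 0 ⟨by linarith, hp.le⟩ θ hθ).1
  obtain ⟨δ, hδ, hball⟩ := Metric.isOpen_iff.1 isOpen_interior θ hθ
  obtain ⟨c, hc, hsep⟩ := DebiasedWhittle.exists_sum_sq_sub_ge hΔ hfmin hΘ hθ hbound hr hident hcont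
    (fun n hn ω hω => (hsmooth n hn ω hω).differentiableOn (by norm_num))
    (fun n hn ω hω γ hγ => (hC n hn ω hω γ hγ).1)
    (fun u hu => DebiasedWhittle.exists_fderiv_ne_zero_of_isTheta hΔ (hnonzero u hu))
  set A := C / fmin ^ 2 + 2 * C ^ 2 / fmin ^ 3 with hA
  have hexp : ∀ (n : ℕ) (k : ℤ), ∃ L : EuclideanSpace ℝ (Fin p) →L[ℝ] ℝ, 0 < n →
      k ∈ DebiasedWhittle.fourierIndices n → ‖L‖ ≤ A ∧ ∀ ρ < δ, ∀ γ ∈ Metric.closedBall θ ρ,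
      ∀ γ' ∈ Metric.closedBall θ ρ,
        |((DebiasedWhittle.expectedPeriodogram Δ n (fun ν => f ν γ)
              (DebiasedWhittle.fourierFreq Δ n k))⁻¹ -
            (DebiasedWhittle.expectedPeriodogram Δ n (fun ν => f ν θ)
              (DebiasedWhittle.fourierFreq Δ n k))⁻¹ - L (γ - θ)) -
          ((DebiasedWhittle.expectedPeriodogram Δ n (fun ν => f ν γ')
              (DebiasedWhittle.fourierFreq Δ n k))⁻¹ -
            (DebiasedWhittle.expectedPeriodogram Δ n (fun ν => f ν θ)
              (DebiasedWhittle.fourierFreq Δ n k))⁻¹ - L (γ' - θ))| ≤ A * ρ * ‖γ - γ'‖ := by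
    intro n k
    by_cases h : 0 < n ∧ k ∈ DebiasedWhittle.fourierIndices n
    · have hω := DebiasedWhittle.fourierFreq_mem_Icc hΔ h.1 h.2
      obtain ⟨L, hL⟩ := DebiasedWhittle.exists_inv_expansion hδ hfmin
        (fun γ hγ => (ha n h.1 _ γ (interior_subset (hball hγ))).1)
        ((hsmooth n h.1 _ hω).mono hball)
        (fun γ hγ => (hC n h.1 _ hω γ (hball hγ)).1) (fun γ hγ => (hC n h.1 _ hω γ (hball hγ)).2)
      exact ⟨L, fun _ _ => hL⟩
    · exact ⟨0, fun h1 h2 => absurd ⟨h1, h2⟩ h⟩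
  choose L hL using hexp
  -- The smoothness radius is halved since the expansion holds on balls strictly inside `ball θ δ`.
  have hfluct : ∀ n : ℕ, 0 < n → _ := fun n hn =>
    DebiasedWhittle.periodogram_fluctuation hΔ (hspec θ hθΘ) hgauss (M := fmax)
      (fun ν hν => ⟨hfmin.le.trans (hbound θ hθΘ ν hν).1, (hbound θ hθΘ ν hν).2⟩) hn
      (fun k w => DebiasedWhittle.periodogram Δ n
          (fun t => DebiasedWhittle.sampled (X θ) Δ t w) (DebiasedWhittle.fourierFreq Δ n k) -
        DebiasedWhittle.expectedPeriodogram Δ n (fun ν => f ν θ)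
          (DebiasedWhittle.fourierFreq Δ n k)) (fun _ _ => rfl)
  refine DebiasedWhittle.isBigOInProb_of_noise (S := DebiasedWhittle.fourierIndices)
    DebiasedWhittle.card_fourierIndices (K := 2 * fmax ^ 2)
    (N := fun n k w => DebiasedWhittle.periodogram Δ n
          (fun t => DebiasedWhittle.sampled (X θ) Δ t w) (DebiasedWhittle.fourierFreq Δ n k) -
        DebiasedWhittle.expectedPeriodogram Δ n (fun ν => f ν θ)
          (DebiasedWhittle.fourierFreq Δ n k))
    (fun n hn => (hfluct n hn).1) (fun n hn => (hfluct n hn).2.1) (fun n hn => (hfluct n hn).2.2)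
    (g := fun n k γ => (DebiasedWhittle.expectedPeriodogram Δ n (fun ν => f ν γ)
          (DebiasedWhittle.fourierFreq Δ n k))⁻¹) (L := L) (Θ := Θ) (c := (4 * fmax ^ 2)⁻¹ * c)
    (δ := δ / 2) (A := A) (G := fmin⁻¹) hθΘ (by positivity) (half_pos hδ) (by positivity)
    (fun n hn k hk γ hγ => ?_) (fun n hn k hk => (hL n k hn hk).1)
    (fun n hn k hk ρ hρ => (hL n k hn hk).2 ρ (hρ.trans_lt (half_lt_self hδ))) (fun η hη => ?_) ?_
  · have h1 := (ha n hn (DebiasedWhittle.fourierFreq Δ n k) γ hγ).1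
    have h2 := hfmin.trans_le h1
    rw [abs_of_pos (inv_pos.2 h2)]
    gcongr
  · obtain ⟨Γ, hΓ, h⟩ := DebiasedWhittle.exists_finset_sum_sq_sub_le hΔ hfmin hΘ hbound hr hcont
      (show 0 < fmin ^ 4 * η ^ 2 by positivity)
    refine ⟨Γ, hΓ, fun γ hγ => ?_⟩
    obtain ⟨γ', hγ', hle⟩ := h γ hγ
    refine ⟨γ', hγ', fun n hn => ?_⟩
    calc _ ≤ ∑ k ∈ DebiasedWhittle.fourierIndices n, (fmin ^ 4)⁻¹ *
          (DebiasedWhittle.expectedPeriodogram Δ n (fun ν => f ν γ)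
              (DebiasedWhittle.fourierFreq Δ n k) -
            DebiasedWhittle.expectedPeriodogram Δ n (fun ν => f ν γ')
              (DebiasedWhittle.fourierFreq Δ n k)) ^ 2 :=
          Finset.sum_le_sum fun k _ => DebiasedWhittle.inv_sub_inv_sq_le hfmin
            (ha n hn _ γ hγ).1 (ha n hn _ γ' (hΓ hγ')).1
      _ ≤ (fmin ^ 4)⁻¹ * (fmin ^ 4 * η ^ 2 * n) := by
          rw [← Finset.mul_sum]
          gcongr
          exact hle n hn
      _ = η ^ 2 * n := by field_simp
  · filter_upwards [hsep, eventually_gt_atTop 0] with n hn hn0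
    filter_upwards [hmax n hn0] with w hw
    refine ⟨hw.1, ?_⟩
    have h1 := hn _ hw.1
    have h2 := hw.2 hθΘ
    simp only [Set.mem_ofPred_eq, DebiasedWhittle.debiasedWhittle, neg_le_neg_iff] at h2
    have h3 := DebiasedWhittle.sum_sq_sub_le_of_sum_log_le
      (fun k _ => ⟨hfmin.trans_le (ha n hn0 _ θ hθΘ).1, (ha n hn0 _ θ hθΘ).2⟩)
      (fun k _ => ⟨hfmin.trans_le (ha n hn0 _ _ hw.1).1, (ha n hn0 _ _ hw.1).2⟩) h2
    refine le_trans ?_ h3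
    rw [mul_assoc, mul_assoc, ← mul_assoc c]
    gcongr
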